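/- **Setting.** Let $d\ge 1$, $s\ge 1$ be integers, $\beta>-d-s$ real, and $\lambda_0,\dots,\lambda_{s-1}>0$. Let $\mathbb V=\{(x,t)\in\mathbb R^d\times\mathbb R:\|x\|=t,\ 0\le t\le 1\}$ be the conic surface, with the measure $\int_{\mathbb V} g\,d\mathsf m=\int_0^1 t^{d-1}\int_{\mathbb S^{d-1}}g(t\xi,t)\,d\sigma(\xi)\,dt$, where $d\sigma$ is the surface measure and $\omega_d$ the surface area of $\mathbb S^{d-1}$. For $\gamma>-1$ and $\alpha>-d$ put $\mathsf w_{\alpha,\gamma}(t)=t^{\alpha}(1-t)^{\gamma}$. For functions $f(x,t)$, $\partial_t$ is the partial derivative in the last variable with $x$ fixed (one-sided from $t\le1$ at $t=1$). A *solid harmonic* of degree $m$ is a homogeneous harmonic polynomial of degree $m$ on $\mathbb R^d$; its restriction to $\mathbb S^{d-1}$ is a *spherical harmonic* of degree $m$, and $\operatorname{proj}^{\mathbb S^{d-1}}_m$ is the orthogonal projection in $L^2(\mathbb S^{d-1})$ onto the spherical harmonics of degree $m$. Polynomials of degree at most $n$ on $\mathbb V$ are represented, uniquely modulo $t^2-\|x\|^2$,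 as linear combinations of $t^jY(x)$ with $Y$ a solid harmonic of degree $m$ and $j+m\le n$; this representative is used when $\partial_t$ is applied to a polynomial and when it is evaluated at points with $\|x\|\ne t$. Given an inner product, the orthogonal polynomials of degree $n$ are the polynomials of degree at most $n$ on $\mathbb V$ that are orthogonal to all those of degree less than $n$. Let $\operatorname{proj}^{\alpha,\gamma}_n$ be the orthogonal projection onto the orthogonal polynomials of degree $n$ for the normalized inner product of $L^2(\mathbb V,\mathsf w_{\alpha,\gamma})$, and let $\operatorname{proj}^{\beta,-s}_n$ be that for the Sobolev inner product $$\langle f,g\rangle_{\beta,-s}=\frac1{\omega_d}\int_{\mathbb V}\partial_t^sf\,\partial_t^sg\;t^{\beta+s}\,d\mathsf m+\sum_{k=0}^{s-1}\frac{\lambda_k}{\omega_d}\int_{\mathbb S^{d-1}}\partial_t^kf(\xi,1)\,\partial_t^kg(\xi,1)\,d\sigma(\xi).$$ Projections of negative degree are $0$. **Theorem.** Let $f$ be a real function that is $s$ times differentiable in $t$ near $\mathbb V\setminus\{(0,0)\}$, within $t\le 1$ (at $t=1$ it suffices that the $t$-derivatives of order less than $s$ exist and are continuous in $t$), with $\partial_t^sf\in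 L^2(\mathbb V,\mathsf w_{\beta+s,0})$ and $\partial_t^kf(\cdot,1)\in L^2(\mathbb S^{d-1})$ for $0\le k<s$. Then for every $n\ge 0$ the projections $\operatorname{proj}_n^{\beta,-s}f$, $\operatorname{proj}^{\mathbb S^{d-1}}_{n-m}[\partial_t^mf(\cdot,1)]$ ($0\le m<s$) and $\operatorname{proj}^{\beta+s,0}_{n-s}(\partial_t^sf)$ exist and are unique, and for all $(x,t)\in\mathbb V$ and $\xi\in\mathbb S^{d-1}$ with $x=t\xi$, $$\operatorname{proj}_n^{\beta,-s}f(x,t)=\sum_{\substack{0\le m\le s-1\\ m\le n}}\frac{(t-1)^m}{m!}\,t^{\,n-m}\operatorname{proj}^{\mathbb S^{d-1}}_{n-m}\big[\partial_t^mf(\cdot,1)\big](\xi)+(-1)^s\int_t^1\frac{(v-t)^{s-1}}{(s-1)!}\operatorname{proj}^{\beta+s,0}_{n-s}(\partial_t^sf)(x,v)\,dv .$$ Here $t^{n-m}\operatorname{proj}^{\mathbb S^{d-1}}_{n-m}[\,\cdot\,](\xi)$ is the value at $x=t\xi$ of the solid harmonic whose restriction to the sphere is the projection. -/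

import Mathlib

open MeasureTheory

namespace ConicSobolev

/-- The Euclidean space `ℝ^d`. -/
abbrev E (d : ℕ) : Type := EuclideanSpace ℝ (Fin d)

/-- The unit sphere `S^{d-1}` in `ℝ^d`. -/
abbrev Sph (d : ℕ) : Type := Metric.sphere (0 : E d) 1

/-! ### Measures -/

/-- The surface measure `dσ` on `S^{d-1}`. -/
noncomputable def sphereMeasure (d : ℕ) : Measure (Sph d) :=
  (volume : Measure (E d)).toSphere

/-- The surface area `ω_d = 2 π^{d/2} / Γ(d/2)` of `S^{d-1}`. -/
noncomputable def omega (d : ℕ) : ℝ :=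
  2 * Real.pi ^ ((d : ℝ) / 2) / Real.Gamma ((d : ℝ) / 2)

/-- The conic surface `{(x,t) : ‖x‖ = t, 0 ≤ t ≤ 1}`. -/
def coneSurface (d : ℕ) : Set (E d × ℝ) :=
  {p | ‖p.1‖ = p.2 ∧ 0 ≤ p.2 ∧ p.2 ≤ 1}

/-- The measure `dm` on the conic surface, normalized by
`∫ g dm = ∫_0^1 t^{d-1} ∫_{S^{d-1}} g(tξ,t) dσ(ξ) dt`. -/
noncomputable def coneMeasure (d : ℕ) : Measure (E d × ℝ) :=
  (((sphereMeasure d).prod (volume.restrict (Set.Ioc (0 : ℝ) 1))).withDensity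
    (fun q => ENNReal.ofReal (q.2 ^ (d - 1)))).map
    (fun q => (q.2 • (q.1 : E d), q.2))

/-- The measure `w_{β,γ} dm`, where `w_{β,γ}(t) = t^β (1-t)^γ`. -/
noncomputable def coneWeighted (d : ℕ) (β γ : ℝ) : Measure (E d × ℝ) :=
  (coneMeasure d).withDensity
    (fun p => ENNReal.ofReal (p.2 ^ β * (1 - p.2) ^ γ))

/-! ### Derivatives in the last variable -/

/-- `∂_t^k f (x,t)`: the `k`-th partial derivative in the last variable, `x` being fixed.
It is one-sided at `t = 1` and is the ordinary partial derivative for `t < 1`. -/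
noncomputable def tDeriv {d : ℕ} (k : ℕ) (f : E d × ℝ → ℝ) (p : E d × ℝ) : ℝ :=
  iteratedDerivWithin k (fun τ => f (p.1, τ)) (Set.Iic 1) p.2

/-- The restriction `ξ ↦ ∂_t^k f (ξ,1)` to the rim of the cone. -/
noncomputable def rimDeriv {d : ℕ} (k : ℕ) (f : E d × ℝ → ℝ) (ξ : Sph d) : ℝ :=
  tDeriv k f ((ξ : E d), 1)

/-- `f` is `s` times differentiable in `t` near the conic surface without its apex:
in a neighbourhood `U`, within `t ≤ 1`, the derivatives of order less than `s` exist and are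
continuous in `t`, and the derivative of order `s` exists where `t < 1`. -/
def TDifferentiable {d : ℕ} (s : ℕ) (f : E d × ℝ → ℝ) : Prop :=
  ∃ U : Set (E d × ℝ), IsOpen U ∧ (∀ p ∈ coneSurface d, 0 < p.2 → p ∈ U) ∧
    ∀ (x : E d) (t : ℝ), (x, t) ∈ U → t ≤ 1 → ∀ k < s,
      ContinuousWithinAt (fun τ => tDeriv k f (x, τ)) (Set.Iic 1) t ∧
      (k + 1 < s ∨ t < 1 →
        DifferentiableWithinAt ℝ (fun τ => tDeriv k f (x, τ)) (Set.Iic 1) t)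

/-! ### Orthogonal projections -/

/-- `p` is an orthogonal projection of `f` onto `W` with respect to the bilinear form `B`:
`p ∈ W`, and `B f q = B p q` for every `q ∈ W`. -/
def IsOrthProj {V : Type*} [AddCommGroup V] [Module ℝ V]
    (B : V → V → ℝ) (W : Submodule ℝ V) (f p : V) : Prop :=
  p ∈ W ∧ ∀ q ∈ W, B f q = B p q

open Classical in
/-- The orthogonal projection of `f` onto `W` (zero if there is none). -/
noncomputable def orthProj {V : Type*} [AddCommGroup V] [Module ℝ V]
    (B : V → V → ℝ) (W : Submodule ℝ V) (f : V) : V :=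
  if h : ∃ p, IsOrthProj B W f p then h.choose else 0

/-! ### Spherical harmonics -/

/-- The Laplacian of a polynomial in `d` variables. -/
noncomputable def polyLaplacian (d : ℕ) :
    MvPolynomial (Fin d) ℝ →ₗ[ℝ] MvPolynomial (Fin d) ℝ :=
  ∑ i : Fin d, (MvPolynomial.pderiv i).toLinearMap ∘ₗ (MvPolynomial.pderiv i).toLinearMap

/-- Solid harmonics of degree `m`: homogeneous harmonic polynomials of degree `m`. -/
noncomputable def solidHarmonics (d m : ℕ) : Submodule ℝ (MvPolynomial (Fin d) ℝ) :=
  MvPolynomial.homogeneousSubmodule (Fin d) ℝ m ⊓ LinearMap.ker (polyLaplacian d)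

/-- The value of a polynomial at a point of `ℝ^d`. -/
noncomputable def polyVal {d : ℕ} (Y : MvPolynomial (Fin d) ℝ) (x : E d) : ℝ :=
  MvPolynomial.eval (fun i => x i) Y

/-- Restriction of polynomials to the unit sphere. -/
noncomputable def restrictSphere (d : ℕ) :
    MvPolynomial (Fin d) ℝ →ₗ[ℝ] (Sph d → ℝ) where
  toFun Y ξ := polyVal Y (ξ : E d)
  map_add' _ _ := by ext; simp [polyVal]
  map_smul' _ _ := by ext; simp [polyVal]

/-- Spherical harmonics of degree `m`: restrictions of solid harmonics to the sphere. -/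
noncomputable def sphericalHarmonics (d m : ℕ) : Submodule ℝ (Sph d → ℝ) :=
  (solidHarmonics d m).map (restrictSphere d)

/-- The normalized inner product of `L²(S^{d-1})`. -/
noncomputable def sphereInner (d : ℕ) (f g : Sph d → ℝ) : ℝ :=
  1 / omega d * ∫ ξ, f ξ * g ξ ∂(sphereMeasure d)

/-- `proj_n^{S^{d-1}}`. -/
noncomputable def sphereProj (d n : ℕ) (f : Sph d → ℝ) : Sph d → ℝ :=
  orthProj (sphereInner d) (sphericalHarmonics d n) f

/-! ### Polynomials on the conic surface -/

/-- Polynomials of degree at most `n` on the conic surface. Modulo the ideal generated by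
`t² - ‖x‖²` every polynomial in `(x,t)` has exactly one representative which is a linear
combination of products `t^j Y(x)` with `Y` a solid harmonic. This representative is the one
which `∂_t` acts on, and which gives the values at points `(x,t)` with `‖x‖ ≠ t`. -/
noncomputable def conePoly (d n : ℕ) : Submodule ℝ (E d × ℝ → ℝ) :=
  Submodule.span ℝ {g | ∃ (j m : ℕ) (Y : MvPolynomial (Fin d) ℝ), j + m ≤ n ∧
    Y ∈ solidHarmonics d m ∧ g = fun p => p.2 ^ j * polyVal Y p.1}

/-- `P` is a polynomial of degree at most `n` on the conic surface which is orthogonal, with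
respect to `B`, to all polynomials of lower degree. -/
def IsOrthPoly (d : ℕ) (B : (E d × ℝ → ℝ) → (E d × ℝ → ℝ) → ℝ) (n : ℕ)
    (P : E d × ℝ → ℝ) : Prop :=
  P ∈ conePoly d n ∧ ∀ k < n, ∀ Q ∈ conePoly d k, B P Q = 0

/-- The space of orthogonal polynomials of degree `n` with respect to `B`. (On polynomials the
forms `B` below are bilinear, so that the polynomials with the defining property already
form a subspace, and the span adds nothing.) -/
noncomputable def orthPolys (d : ℕ) (B : (E d × ℝ → ℝ) → (E d × ℝ → ℝ) → ℝ) (n : ℕ) :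
    Submodule ℝ (E d × ℝ → ℝ) :=
  Submodule.span ℝ {P | IsOrthPoly d B n P}

/-- `b_{β,γ} = c_{β+d-1,γ} / ω_d` with `c_{a,b} = Γ(a+b+2) / (Γ(a+1) Γ(b+1))`. -/
noncomputable def coneNormConst (d : ℕ) (β γ : ℝ) : ℝ :=
  1 / omega d * (Real.Gamma (β + d + γ + 1) / (Real.Gamma (β + d) * Real.Gamma (γ + 1)))

/-- The inner product of `L²` of the conic surface with the weight `w_{β,γ}`. -/
noncomputable def coneInner (d : ℕ) (β γ : ℝ) (f g : E d × ℝ → ℝ) : ℝ :=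
  coneNormConst d β γ * ∫ p, f p * g p ∂(coneWeighted d β γ)

/-- `proj_n^{β,γ}`, the projection onto the orthogonal polynomials of degree `n` for `w_{β,γ}`. -/
noncomputable def coneProj (d : ℕ) (β γ : ℝ) (n : ℕ) (f : E d × ℝ → ℝ) : E d × ℝ → ℝ :=
  orthProj (coneInner d β γ) (orthPolys d (coneInner d β γ) n) f

/-- The Sobolev inner product `⟨f,g⟩_{β,-s}` with the positive constants `lam 0, …, lam (s-1)`. -/
noncomputable def sobolevInner (d : ℕ) (β : ℝ) (s : ℕ) (lam : ℕ → ℝ)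
    (f g : E d × ℝ → ℝ) : ℝ :=
  1 / omega d * (∫ p, tDeriv s f p * tDeriv s g p ∂(coneWeighted d (β + s) 0)) +
    ∑ k ∈ Finset.range s, lam k / omega d *
      ∫ ξ, rimDeriv k f ξ * rimDeriv k g ξ ∂(sphereMeasure d)

/-- `proj_n^{β,-s}`, the projection onto the Sobolev orthogonal polynomials of degree `n`. -/
noncomputable def sobolevProj (d : ℕ) (β : ℝ) (s : ℕ) (lam : ℕ → ℝ) (n : ℕ)
    (f : E d × ℝ → ℝ) : E d × ℝ → ℝ :=
  orthProj (sobolevInner d β s lam) (orthPolys d (sobolevInner d β s lam) n) f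

end ConicSobolev

namespace ConicSobolev

/-! Write `J` for the primitive in `t`, with `x` fixed, that vanishes at `t = 1` (`lastPrimitive`).
Taylor expansion at `t = 1` identifies a polynomial `q` with its data: the rim values `∂_t^k q(·,1)`
for `k < s`, and `∂_t^s q`. The inverse map is `(Y, P) ↦ ∑ J^m Y_m + J^s P`. The Sobolev form is a
positive combination of the L² forms of the separate data. Since `∂_t` and `J` act on `t^j Y(x)`
only through `t^j`, the first lowers the degree by one and the second raises it by at most one.

Hence the orthogonality conditions decouple. Testing against `J^s R` isolates the integral over the
cone, and testing against `J^k Z` with a solid harmonic `Z` isolates the `k`-th rim term. So a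
Sobolev orthogonal polynomial `q` of degree `n` has `∂_t^s q` orthogonal of degree `n - s` for the
weight `t^(β+s)` (`lastDeriv_mem_orthPolys`), and each `∂_t^k q(·,1)` is a single solid harmonic of
degree `n - k` (`exists_rim_lastDeriv`). The converse is `ofRimData_mem_orthPolys`. Assembling the
projections of the data of `f` therefore gives the projection of `f`, one summand at a time
(`isOrthProj_ofRimData`). The formulas `J^m Y = (t-1)^m/m! · Y` and Cauchy's formula for `J^s` make
it explicit.

Two facts underlie this. Solid harmonics of different degrees are orthogonal on the sphere
(`integral_sphere_solidHarmonics_mul`). The chosen representative of a polynomial is determined by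
its values on the cone (`conePoly_eq_zero_of_cone`), so the forms are definite and projections are
unique. -/

instance (d : ℕ) : IsFiniteMeasure (sphereMeasure d) := by
  unfold sphereMeasure; infer_instance

instance (d : ℕ) : (sphereMeasure d).IsOpenPosMeasure := by
  unfold sphereMeasure; infer_instance

/-! ### Solid harmonics as functions -/

lemma nontrivial_E {d : ℕ} (hd : 1 ≤ d) : Nontrivial (E d) := by
  have : Nonempty (Fin d) := ⟨⟨0, hd⟩⟩
  infer_instance

lemma continuous_polyVal {d : ℕ} (Y : MvPolynomial (Fin d) ℝ) : Continuous (polyVal Y) := by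
  unfold polyVal
  exact (MvPolynomial.continuous_eval Y).comp (by fun_prop)

lemma polyVal_smul {d m : ℕ} {Y : MvPolynomial (Fin d) ℝ} (hY : Y.IsHomogeneous m)
    (r : ℝ) (x : E d) : polyVal Y (r • x) = r ^ m * polyVal Y x := by
  unfold polyVal
  rw [MvPolynomial.eval_eq, MvPolynomial.eval_eq, Finset.mul_sum]
  refine Finset.sum_congr rfl fun c hc => ?_
  have h1 := hY.degree_eq_sum_deg_support hc
  simp only [PiLp.smul_apply, smul_eq_mul, mul_pow, Finset.prod_mul_distrib]
  rw [Finset.prod_pow_eq_pow_sum, ← h1]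
  ring

lemma hasLineDerivAt_polyVal {d : ℕ} (Y : MvPolynomial (Fin d) ℝ) (i : Fin d) (x : E d) :
    HasLineDerivAt ℝ (polyVal Y) (polyVal (MvPolynomial.pderiv i Y) x) x
      (EuclideanSpace.single i 1) := by
  induction Y using MvPolynomial.induction_on with
  | C a =>
    simpa [polyVal, HasLineDerivAt] using hasDerivAt_const (0 : ℝ) a
  | add p q hp hq =>
    unfold HasLineDerivAt at *
    simpa [polyVal] using HasDerivAt.fun_add hp hq
  | mul_X p j hp =>
    unfold HasLineDerivAt at *
    have hX : HasDerivAt (fun t : ℝ => (x + t • EuclideanSpace.single i (1 : ℝ)) j)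
        (if j = i then 1 else 0) 0 := by
      have := ((hasDerivAt_id (0 : ℝ)).mul_const (if j = i then (1 : ℝ) else 0)).const_add (x j)
      simpa using this
    have := HasDerivAt.fun_mul hp hX
    have h (y : E d) : polyVal (p * MvPolynomial.X j) y = polyVal p y * y j := by simp [polyVal]
    simp_rw [h]
    refine this.congr_deriv ?_
    simp only [polyVal, Derivation.leibniz, MvPolynomial.pderiv_X, smul_eq_mul, map_add, map_mul,
      MvPolynomial.eval_X, zero_smul, add_zero, Pi.single_apply]
    split_ifs <;> simp <;> ring

/-! ### Orthogonality of solid harmonics of different degrees on the sphere -/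

lemma hasDerivAt_max_zero_sq (u : ℝ) :
    HasDerivAt (fun v : ℝ => max 0 v ^ 2) (2 * max 0 u) u := by
  -- As the integral of a continuous function, the square is differentiable at the kink `0` as well.
  have h (v : ℝ) : max 0 v ^ 2 = ∫ y in (0 : ℝ)..v, 2 * max 0 y := by
    rcases le_total 0 v with hv | hv
    · have : ∫ y in (0 : ℝ)..v, 2 * max 0 y = ∫ y in (0 : ℝ)..v, 2 * y :=
        intervalIntegral.integral_congr fun y hy => by
          rw [Set.uIcc_of_le hv] at hy
          have := max_eq_right hy.1
          rw [this]
      rw [this, max_eq_right hv, intervalIntegral.integral_const_mul, integral_id]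
      ring
    · have : ∫ y in (0 : ℝ)..v, 2 * max 0 y = ∫ y in (0 : ℝ)..v, (0 : ℝ) :=
        intervalIntegral.integral_congr fun y hy => by
          rw [Set.uIcc_of_ge hv] at hy
          have := max_eq_left hy.2
          rw [this, mul_zero]
      rw [this, max_eq_left hv]
      simp
  simp_rw [h]
  have hc : Continuous fun y : ℝ => 2 * max 0 y := by fun_prop
  exact hc.integral_hasStrictDerivAt 0 u |>.hasDerivAt

/-- A `C¹` radial cut-off function. -/
noncomputable def radialBump (d : ℕ) (x : E d) : ℝ := max 0 (1 - ‖x‖ ^ 2) ^ 2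

lemma hasLineDerivAt_radialBump {d : ℕ} (i : Fin d) (x : E d) :
    HasLineDerivAt ℝ (radialBump d) (-4 * (max 0 (1 - ‖x‖ ^ 2) * x i)) x
      (EuclideanSpace.single i 1) := by
  unfold HasLineDerivAt radialBump
  have h1 (t : ℝ) : ‖x + t • EuclideanSpace.single i (1 : ℝ)‖ ^ 2 = ‖x‖ ^ 2 + 2 * t * x i + t ^ 2 := by
    rw [norm_add_sq_real]
    simp [norm_smul, inner_smul_right, EuclideanSpace.inner_single_right]
    ring
  simp_rw [h1]
  have h2 : HasDerivAt (fun t : ℝ => 1 - (‖x‖ ^ 2 + 2 * t * x i + t ^ 2)) (-(2 * x i)) 0 := by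
    have a := ((hasDerivAt_id (0 : ℝ)).const_mul 2).mul_const (x i)
    have b := hasDerivAt_pow 2 (0 : ℝ)
    have := ((a.const_add (‖x‖ ^ 2)).add b).const_sub 1
    simpa using this
  have := (hasDerivAt_max_zero_sq (1 - (‖x‖ ^ 2 + 2 * 0 * x i + 0 ^ 2))).comp (0 : ℝ) h2
  refine this.congr_deriv ?_
  simp only [mul_zero, zero_mul, add_zero, ne_eq, OfNat.ofNat_ne_zero, not_false_eq_true, zero_pow]
  ring

lemma hasCompactSupport_max_one_sub_norm_sq (d : ℕ) :
    HasCompactSupport fun x : E d => max 0 (1 - ‖x‖ ^ 2) := by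
  refine HasCompactSupport.intro (isCompact_closedBall (0 : E d) 1) fun x hx => ?_
  have : 1 < ‖x‖ := by simpa using hx
  rw [max_eq_left]
  nlinarith

lemma hasCompactSupport_radialBump (d : ℕ) : HasCompactSupport (radialBump d) :=
  (hasCompactSupport_max_one_sub_norm_sq d).comp_left (g := fun y => y ^ 2) (by simp)

lemma continuous_radialBump (d : ℕ) : Continuous (radialBump d) := by
  unfold radialBump; fun_prop

/-- Integration by parts, the gradient of the cut-off being `-4 (1 - ‖x‖²)₊ x`. Summed over `i`, it
turns a divergence into a radial component. -/
lemma integral_radialBump_mul_pderiv {d : ℕ} (U : MvPolynomial (Fin d) ℝ) (i : Fin d) :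
    ∫ x, radialBump d x * polyVal (MvPolynomial.pderiv i U) x =
      4 * ∫ x, max 0 (1 - ‖x‖ ^ 2) * polyVal (MvPolynomial.X i * U) x := by
  have hm : Continuous fun x : E d => max 0 (1 - ‖x‖ ^ 2) := by fun_prop
  have key := integral_bilinear_hasLineDerivAt_right_eq_neg_left_of_integrable
    (μ := (volume : Measure (E d))) (B := ContinuousLinearMap.mul ℝ ℝ)
    (f := radialBump d) (g := polyVal U) (v := EuclideanSpace.single i 1)
    (f' := fun x => -4 * (max 0 (1 - ‖x‖ ^ 2) * x i))
    (g' := polyVal (MvPolynomial.pderiv i U)) ?_ ?_ ?_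
    (fun x _ => hasLineDerivAt_radialBump i x) (fun x _ => hasLineDerivAt_polyVal U i x)
  · simp only [ContinuousLinearMap.mul_apply'] at key
    rw [key, ← integral_neg, ← integral_const_mul]
    congr 1
    ext x
    simp [polyVal]
    ring
  · have hU := continuous_polyVal U
    refine Continuous.integrable_of_hasCompactSupport ?_ ?_
    · simp only [ContinuousLinearMap.mul_apply']
      fun_prop
    · simp only [ContinuousLinearMap.mul_apply']
      exact (((hasCompactSupport_max_one_sub_norm_sq d).mul_right).mul_left).mul_right
  · exact Continuous.integrable_of_hasCompactSupport
      ((continuous_radialBump d).mul (continuous_polyVal _))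
      (hasCompactSupport_radialBump d).mul_right
  · exact Continuous.integrable_of_hasCompactSupport
      ((continuous_radialBump d).mul (continuous_polyVal _))
      (hasCompactSupport_radialBump d).mul_right

/-- Green's identity in a ball without boundary terms: the field `U = Y ∇Z - Z ∇Y` is divergence
free because `Y` and `Z` are harmonic, while Euler's identity gives `x · U = (n - m) Y Z`.
Integrating `div U` against the cut-off leaves `n - m` times the integral in question. -/
lemma integral_max_mul_solidHarmonics {d m n : ℕ} (hmn : m ≠ n)
    {Y Z : MvPolynomial (Fin d) ℝ} (hY : Y ∈ solidHarmonics d m) (hZ : Z ∈ solidHarmonics d n) :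
    ∫ x : E d, max 0 (1 - ‖x‖ ^ 2) * (polyVal Y x * polyVal Z x) = 0 := by
  obtain ⟨hY1, hY2⟩ := Submodule.mem_inf.1 hY
  obtain ⟨hZ1, hZ2⟩ := Submodule.mem_inf.1 hZ
  have hY1 : Y.IsHomogeneous m := hY1
  have hZ1 : Z.IsHomogeneous n := hZ1
  set U : Fin d → MvPolynomial (Fin d) ℝ := fun i =>
    Y * MvPolynomial.pderiv i Z - Z * MvPolynomial.pderiv i Y with hU
  have hY3 : ∑ i, MvPolynomial.pderiv i (MvPolynomial.pderiv i Y) = 0 := by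
    simpa [polyLaplacian] using hY2
  have hZ3 : ∑ i, MvPolynomial.pderiv i (MvPolynomial.pderiv i Z) = 0 := by
    simpa [polyLaplacian] using hZ2
  have h1 : ∑ i, MvPolynomial.pderiv i (U i) = 0 := by
    have : ∀ i, MvPolynomial.pderiv i (U i) =
        Y * MvPolynomial.pderiv i (MvPolynomial.pderiv i Z) -
          Z * MvPolynomial.pderiv i (MvPolynomial.pderiv i Y) := by
      intro i
      simp only [hU, map_sub, Derivation.leibniz, smul_eq_mul]
      ring
    simp_rw [this]
    rw [Finset.sum_sub_distrib, ← Finset.mul_sum, ← Finset.mul_sum, hY3, hZ3]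
    simp
  have h2 : ∑ i, MvPolynomial.X i * U i = ((n : ℝ) - m) • (Y * Z) := by
    have : ∀ i, MvPolynomial.X i * U i = Y * (MvPolynomial.X i * MvPolynomial.pderiv i Z) -
        Z * (MvPolynomial.X i * MvPolynomial.pderiv i Y) := fun i => by simp only [hU]; ring
    simp_rw [this]
    rw [Finset.sum_sub_distrib, ← Finset.mul_sum, ← Finset.mul_sum, hY1.sum_X_mul_pderiv,
      hZ1.sum_X_mul_pderiv, sub_smul, ← Nat.cast_smul_eq_nsmul ℝ, ← Nat.cast_smul_eq_nsmul ℝ,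
      mul_smul_comm, mul_smul_comm, mul_comm Z Y]
  have hc : Continuous fun x : E d => max 0 (1 - ‖x‖ ^ 2) := by fun_prop
  have h3 := Finset.sum_congr rfl fun i (_ : i ∈ Finset.univ) =>
    integral_radialBump_mul_pderiv (U i) i
  rw [← Finset.mul_sum, ← integral_finsetSum, ← integral_finsetSum] at h3
  · have h4 (x : E d) : ∑ i, radialBump d x * polyVal (MvPolynomial.pderiv i (U i)) x = 0 := by
      rw [← Finset.mul_sum]
      have := congrArg (fun P => polyVal P x) h1
      simp only [polyVal, map_sum, map_zero] at this ⊢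
      rw [this, mul_zero]
    have h5 (x : E d) : ∑ i, max 0 (1 - ‖x‖ ^ 2) * polyVal (MvPolynomial.X i * U i) x =
        ((n : ℝ) - m) * (max 0 (1 - ‖x‖ ^ 2) * (polyVal Y x * polyVal Z x)) := by
      rw [← Finset.mul_sum]
      have := congrArg (fun P => polyVal P x) h2
      simp only [polyVal, map_sum, MvPolynomial.smul_eval, map_mul] at this ⊢
      rw [this]
      ring
    simp_rw [h4, h5] at h3
    rw [integral_const_mul] at h3
    have : (n : ℝ) - m ≠ 0 := sub_ne_zero.2 (by exact_mod_cast hmn.symm)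
    simpa [this] using h3.symm
  · exact fun i _ => Continuous.integrable_of_hasCompactSupport (hc.mul (continuous_polyVal _))
      (hasCompactSupport_max_one_sub_norm_sq d).mul_right
  · exact fun i _ => Continuous.integrable_of_hasCompactSupport
      ((continuous_radialBump d).mul (continuous_polyVal _))
      (hasCompactSupport_radialBump d).mul_right

/-- Polar coordinates. Homogeneity is required for positive radii only, so that `‖x‖ ^ k` is
admitted along with polynomials. -/
lemma integral_radial_mul_homogeneous {d : ℕ} (hd : 1 ≤ d) (g : ℝ → ℝ) {F : E d → ℝ} {k : ℕ}
    (hF : ∀ (r : ℝ) (ξ : Sph d), 0 < r → F (r • (ξ : E d)) = r ^ k * F ξ) :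
    ∫ x, g ‖x‖ * F x = (∫ ξ : Sph d, F ξ ∂(sphereMeasure d)) *
      ∫ r : Set.Ioi (0 : ℝ), g r * (r : ℝ) ^ k ∂(Measure.volumeIoiPow (d - 1)) := by
  have := nontrivial_E hd
  have hp := (volume : Measure (E d)).measurePreserving_homeomorphUnitSphereProd
  rw [finrank_euclideanSpace_fin] at hp
  calc
    ∫ x, g ‖x‖ * F x = ∫ x : ({(0)}ᶜ : Set (E d)), g ‖x.1‖ * F x.1 ∂(volume.comap Subtype.val) := by
      rw [integral_subtype_comap (measurableSet_singleton _).compl fun x : E d => g ‖x‖ * F x,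
        restrict_compl_singleton]
    _ = ∫ q : Sph d × Set.Ioi (0 : ℝ), F q.1 * (g q.2 * (q.2 : ℝ) ^ k)
          ∂((sphereMeasure d).prod (Measure.volumeIoiPow (d - 1))) := by
      rw [sphereMeasure, ← hp.integral_comp (Homeomorph.measurableEmbedding _)]
      congr 1
      ext x
      have hx : (x : E d) ≠ 0 := x.2
      have h := hF ‖x.1‖ (homeomorphUnitSphereProd (E d) x).1 (norm_pos_iff.2 hx)
      have h' : ‖x.1‖ • ((homeomorphUnitSphereProd (E d) x).1 : E d) = x.1 := by
        simp [smul_smul, hx]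
      rw [h'] at h
      rw [h]
      simp
      ring
    _ = _ := integral_prod_mul (fun ξ : Sph d => F ξ)
        (fun r : Set.Ioi (0 : ℝ) => g r * (r : ℝ) ^ k)

lemma integral_sphere_solidHarmonics_mul {d m n : ℕ} (hd : 1 ≤ d) (hmn : m ≠ n)
    {Y Z : MvPolynomial (Fin d) ℝ} (hY : Y ∈ solidHarmonics d m) (hZ : Z ∈ solidHarmonics d n) :
    ∫ ξ : Sph d, polyVal Y (ξ : E d) * polyVal Z (ξ : E d) ∂(sphereMeasure d) = 0 := by
  have := nontrivial_E hd
  have h0 := integral_max_mul_solidHarmonics hmn hY hZ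
  have h1 := integral_radial_mul_homogeneous hd (fun r => max 0 (1 - r ^ 2))
    (F := fun x => polyVal Y x * polyVal Z x) (k := m + n) fun r ξ _ => by
      rw [polyVal_smul hY.1, polyVal_smul hZ.1]; ring
  -- The same radial factor occurs for `‖x‖ ^ (m + n)`, whose integral is positive; so that factor
  -- is nonzero and need not be computed.
  have h2 := integral_radial_mul_homogeneous hd (fun r => max 0 (1 - r ^ 2))
    (F := fun x => ‖x‖ ^ (m + n)) (k := m + n) fun r ξ hr => by
      simp [norm_smul, abs_of_pos hr]
  have h3 : 0 < ∫ x : E d, max 0 (1 - ‖x‖ ^ 2) * ‖x‖ ^ (m + n) := by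
    obtain ⟨ξ, hξ⟩ := NormedSpace.sphere_nonempty (E := E d) (x := 0) (r := 1 / 2) |>.2 (by norm_num)
    refine Continuous.integral_pos_of_hasCompactSupport_nonneg_nonzero (x := ξ) (by fun_prop)
      (hasCompactSupport_max_one_sub_norm_sq d).mul_right (fun x => by positivity) ?_
    have : ‖ξ‖ = 1 / 2 := by simpa using hξ
    rw [this]
    norm_num
  rw [h2] at h3
  rw [h1] at h0
  exact (mul_eq_zero.1 h0).resolve_right fun h => by simp [h] at h3

/-! ### Polynomials on the cone -/

variable {d : ℕ}

lemma monomial_mem_conePoly {n j m : ℕ} {Y : MvPolynomial (Fin d) ℝ} (h : j + m ≤ n)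
    (hY : Y ∈ solidHarmonics d m) :
    (fun p : E d × ℝ => p.2 ^ j * polyVal Y p.1) ∈ conePoly d n :=
  Submodule.subset_span ⟨j, m, Y, h, hY, rfl⟩

lemma conePoly_mono {n k : ℕ} (h : n ≤ k) : conePoly d n ≤ conePoly d k :=
  Submodule.span_mono fun _ ⟨j, m, Y, hjm, hY, e⟩ => ⟨j, m, Y, hjm.trans h, hY, e⟩

/-- The sum runs over a square, so the bound `j + m ≤ n` is lost; what remains is one solid harmonic
for each pair of exponents. -/
lemma conePoly_normal_form {n : ℕ} {q : E d × ℝ → ℝ} (hq : q ∈ conePoly d n) :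
    ∃ c : ℕ → ℕ → MvPolynomial (Fin d) ℝ, (∀ j m, c j m ∈ solidHarmonics d m) ∧
      q = fun p => ∑ j ∈ Finset.range (n + 1), ∑ m ∈ Finset.range (n + 1),
        p.2 ^ j * polyVal (c j m) p.1 := by
  induction hq using Submodule.span_induction with
  | mem q hq =>
    obtain ⟨j, m, Y, hjm, hY, rfl⟩ := hq
    refine ⟨fun a b => if a = j ∧ b = m then Y else 0, fun a b => ?_, ?_⟩
    · beta_reduce
      split_ifs with h
      · exact h.2 ▸ hY
      · exact zero_mem _
    · ext p
      rw [Finset.sum_eq_single j, Finset.sum_eq_single m]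
      · simp
      · intro b _ hb; simp [hb, polyVal]
      · intro h; exact absurd (Finset.mem_range.2 (by omega)) h
      · intro b _ hb; simp [hb, polyVal]
      · intro h; exact absurd (Finset.mem_range.2 (by omega)) h
  | zero => exact ⟨0, fun _ _ => zero_mem _, by ext; simp [polyVal]⟩
  | add p q _ _ hp hq =>
    obtain ⟨a, ha, rfl⟩ := hp
    obtain ⟨b, hb, rfl⟩ := hq
    refine ⟨fun j m => a j m + b j m, fun j m => add_mem (ha j m) (hb j m), ?_⟩
    ext p
    simp [polyVal, mul_add, Finset.sum_add_distrib]
  | smul r q _ hq =>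
    obtain ⟨a, ha, rfl⟩ := hq
    refine ⟨fun j m => r • a j m, fun j m => Submodule.smul_mem _ r (ha j m), ?_⟩
    ext p
    simp only [polyVal, Pi.smul_apply, smul_eq_mul, Finset.mul_sum, MvPolynomial.smul_eval]
    exact Finset.sum_congr rfl fun _ _ => Finset.sum_congr rfl fun _ _ => by ring

lemma continuous_conePoly {n : ℕ} {q : E d × ℝ → ℝ} (hq : q ∈ conePoly d n) : Continuous q := by
  obtain ⟨c, -, rfl⟩ := conePoly_normal_form hq
  have h (j m : ℕ) := continuous_polyVal (c j m)
  fun_prop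

lemma contDiff_conePoly {n : ℕ} {q : E d × ℝ → ℝ} (hq : q ∈ conePoly d n) (x : E d)
    (N : WithTop ℕ∞) : ContDiff ℝ N fun τ => q (x, τ) := by
  obtain ⟨c, -, rfl⟩ := conePoly_normal_form hq
  exact ContDiff.sum fun j _ => ContDiff.sum fun m _ => (contDiff_id.pow j).mul
    (contDiff_const (c := polyVal (c j m) x))

/-- The map `Y ↦ t^j Y(x)`. -/
noncomputable def coneMonomial (d j : ℕ) : MvPolynomial (Fin d) ℝ →ₗ[ℝ] (E d × ℝ → ℝ) where
  toFun Y p := p.2 ^ j * polyVal Y p.1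
  map_add' _ _ := by ext; simp [polyVal, mul_add]
  map_smul' _ _ := by ext; simp [polyVal]; ring

instance finiteDimensional_conePoly (n : ℕ) : FiniteDimensional ℝ (conePoly d n) := by
  have hfin (m : ℕ) : FiniteDimensional ℝ (MvPolynomial.homogeneousSubmodule (Fin d) ℝ m) :=
    Module.Finite.iff_fg.2 (MvPolynomial.homogeneousSubmodule_fg _ _ m)
  have hle : conePoly d n ≤ ⨆ a : Fin (n + 1) × Fin (n + 1),
      (MvPolynomial.homogeneousSubmodule (Fin d) ℝ a.2).map (coneMonomial d a.1) := by
    refine Submodule.span_le.2 ?_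
    rintro _ ⟨j, m, Y, hjm, hY, rfl⟩
    exact Submodule.mem_iSup_of_mem (⟨⟨j, by omega⟩, ⟨m, by omega⟩⟩ : Fin (n + 1) × Fin (n + 1))
      (Submodule.mem_map_of_mem (f := coneMonomial d j) hY.1)
  exact Submodule.finiteDimensional_of_le hle

instance finiteDimensional_sphericalHarmonics (n : ℕ) :
    FiniteDimensional ℝ (sphericalHarmonics d n) := by
  have : FiniteDimensional ℝ (MvPolynomial.homogeneousSubmodule (Fin d) ℝ n) :=
    Module.Finite.iff_fg.2 (MvPolynomial.homogeneousSubmodule_fg _ _ n)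
  have : FiniteDimensional ℝ (solidHarmonics d n) :=
    Submodule.finiteDimensional_of_le (inf_le_left : _ ≤ MvPolynomial.homogeneousSubmodule _ _ n)
  unfold sphericalHarmonics
  infer_instance

/-! ### Differentiation and integration in the last variable -/

/-- The ordinary partial derivative of order `k` in the last variable. -/
noncomputable def lastDeriv (k : ℕ) (q : E d × ℝ → ℝ) (p : E d × ℝ) : ℝ :=
  iteratedDeriv k (fun τ => q (p.1, τ)) p.2

/-- Passing from the one-sided to the ordinary derivative keeps derivatives of polynomials inside
`conePoly`, as functions on the whole space. -/
lemma tDeriv_eq_lastDeriv {n : ℕ} {q : E d × ℝ → ℝ} (hq : q ∈ conePoly d n) (k : ℕ)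
    {p : E d × ℝ} (hp : p.2 ≤ 1) : tDeriv k q p = lastDeriv k q p :=
  iteratedDerivWithin_eq_iteratedDeriv (uniqueDiffOn_Iic 1)
    (contDiff_conePoly hq p.1 k).contDiffAt hp

lemma rimDeriv_eq_lastDeriv {n : ℕ} {q : E d × ℝ → ℝ} (hq : q ∈ conePoly d n) (k : ℕ)
    (ξ : Sph d) : rimDeriv k q ξ = lastDeriv k q ((ξ : E d), 1) :=
  tDeriv_eq_lastDeriv hq k le_rfl

lemma lastDeriv_zero (q : E d × ℝ → ℝ) : lastDeriv 0 q = q := by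
  ext p; simp [lastDeriv]

lemma lastDeriv_succ (k : ℕ) (q : E d × ℝ → ℝ) :
    lastDeriv (k + 1) q = lastDeriv 1 (lastDeriv k q) := by
  ext p
  simp only [lastDeriv, iteratedDeriv_succ, iteratedDeriv_zero]

lemma lastDeriv_succ' (k : ℕ) (q : E d × ℝ → ℝ) :
    lastDeriv (k + 1) q = lastDeriv k (lastDeriv 1 q) := by
  ext p
  simp only [lastDeriv, iteratedDeriv_one, iteratedDeriv_succ' (n := k)]

lemma lastDeriv_add {n n' : ℕ} {q r : E d × ℝ → ℝ} (hq : q ∈ conePoly d n)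
    (hr : r ∈ conePoly d n') (k : ℕ) : lastDeriv k (q + r) = lastDeriv k q + lastDeriv k r := by
  ext p
  exact iteratedDeriv_add (contDiff_conePoly hq p.1 k).contDiffAt
    (contDiff_conePoly hr p.1 k).contDiffAt

lemma lastDeriv_smul (a : ℝ) (q : E d × ℝ → ℝ) (k : ℕ) :
    lastDeriv k (a • q) = a • lastDeriv k q := by
  ext p
  exact iteratedDeriv_const_smul_field a _

lemma lastDeriv_sum {ι : Type*} (S : Finset ι) {n : ℕ} {q : ι → E d × ℝ → ℝ}
    (hq : ∀ i ∈ S, q i ∈ conePoly d n) (k : ℕ) :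
    lastDeriv k (∑ i ∈ S, q i) = ∑ i ∈ S, lastDeriv k (q i) := by
  classical
  induction S using Finset.induction_on with
  | empty =>
    have := lastDeriv_smul 0 (0 : E d × ℝ → ℝ) k
    simpa using this
  | insert i S hi ih =>
    have h : ∀ j ∈ S, q j ∈ conePoly d n := fun j hj => hq j (Finset.mem_insert_of_mem hj)
    rw [Finset.sum_insert hi, Finset.sum_insert hi, lastDeriv_add (hq i (Finset.mem_insert_self _ _))
      (Submodule.sum_mem _ h), ih h]

lemma lastDeriv_one_monomial (j : ℕ) (Y : MvPolynomial (Fin d) ℝ) :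
    lastDeriv 1 (fun p : E d × ℝ => p.2 ^ j * polyVal Y p.1) =
      (j : ℝ) • fun p => p.2 ^ (j - 1) * polyVal Y p.1 := by
  ext p
  simp [lastDeriv, mul_assoc]

/-- The second clause recovers what truncated subtraction hides: in degree `0` the derivative
vanishes. -/
lemma lastDeriv_one_mem {n : ℕ} {q : E d × ℝ → ℝ} (hq : q ∈ conePoly d n) :
    lastDeriv 1 q ∈ conePoly d (n - 1) ∧ (n = 0 → lastDeriv 1 q = 0) := by
  induction hq using Submodule.span_induction with
  | mem q hq =>
    obtain ⟨j, m, Y, hjm, hY, rfl⟩ := hq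
    rw [lastDeriv_one_monomial]
    rcases Nat.eq_zero_or_pos j with rfl | hj
    · simp
    · exact ⟨Submodule.smul_mem _ _ (monomial_mem_conePoly (by omega) hY), fun h => by omega⟩
  | zero =>
    have := lastDeriv_smul 0 (0 : E d × ℝ → ℝ) 1
    simp only [smul_zero, zero_smul] at this
    simp [this]
  | add p q hp hq ihp ihq =>
    rw [lastDeriv_add hp hq]
    exact ⟨add_mem ihp.1 ihq.1, fun h => by rw [ihp.2 h, ihq.2 h, add_zero]⟩
  | smul r q _ ih =>
    rw [lastDeriv_smul]
    exact ⟨Submodule.smul_mem _ _ ih.1, fun h => by rw [ih.2 h, smul_zero]⟩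

lemma lastDeriv_mem {n : ℕ} {q : E d × ℝ → ℝ} (hq : q ∈ conePoly d n) (k : ℕ) :
    lastDeriv k q ∈ conePoly d (n - k) ∧ (n < k → lastDeriv k q = 0) := by
  induction k with
  | zero => simpa [lastDeriv_zero] using hq
  | succ k ih =>
    rw [lastDeriv_succ]
    have := lastDeriv_one_mem ih.1
    exact ⟨by simpa [Nat.sub_sub] using this.1, fun h => this.2 (by omega)⟩

/-- The primitive in the last variable vanishing on the rim. -/
noncomputable def lastPrimitive (q : E d × ℝ → ℝ) (p : E d × ℝ) : ℝ :=
  ∫ v in (1 : ℝ)..p.2, q (p.1, v)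

lemma lastPrimitive_apply_one (q : E d × ℝ → ℝ) (x : E d) : lastPrimitive q (x, 1) = 0 := by
  simp [lastPrimitive]

lemma lastDeriv_one_lastPrimitive {q : E d × ℝ → ℝ} (hq : Continuous q) :
    lastDeriv 1 (lastPrimitive q) = q := by
  ext p
  have hc : Continuous fun v => q (p.1, v) := by fun_prop
  simpa [lastDeriv, lastPrimitive] using hc.deriv_integral _ 1 p.2

lemma lastPrimitive_mem {n : ℕ} {q : E d × ℝ → ℝ} (hq : q ∈ conePoly d n) :
    lastPrimitive q ∈ conePoly d (n + 1) := by
  have hI {q : E d × ℝ → ℝ} (hq : q ∈ conePoly d n) (x : E d) (a b : ℝ) :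
      IntervalIntegrable (fun v => q (x, v)) volume a b := by
    have := continuous_conePoly hq
    exact Continuous.intervalIntegrable (by fun_prop) a b
  induction hq using Submodule.span_induction with
  | mem q hq =>
    obtain ⟨j, m, Y, hjm, hY, rfl⟩ := hq
    -- Since `x` is held fixed, the constant of integration is a multiple of `Y(x)` itself, of
    -- degree `m`, and no power of `‖x‖` appears.
    have : lastPrimitive (fun p : E d × ℝ => p.2 ^ j * polyVal Y p.1) =
        ((j : ℝ) + 1)⁻¹ • ((fun p => p.2 ^ (j + 1) * polyVal Y p.1) -
          fun p => p.2 ^ 0 * polyVal Y p.1) := by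
      ext p
      simp [lastPrimitive]
      ring
    rw [this]
    exact Submodule.smul_mem _ _ (sub_mem (monomial_mem_conePoly (by omega) hY)
      (monomial_mem_conePoly (by omega) hY))
  | zero =>
    have : lastPrimitive (0 : E d × ℝ → ℝ) = 0 := by ext; simp [lastPrimitive]
    rw [this]; exact zero_mem _
  | add p q hp hq ihp ihq =>
    have : lastPrimitive (p + q) = lastPrimitive p + lastPrimitive q := by
      ext x
      exact intervalIntegral.integral_add (hI hp _ _ _) (hI hq _ _ _)
    rw [this]; exact add_mem ihp ihq
  | smul r q _ ih =>
    have : lastPrimitive (r • q) = r • lastPrimitive q := by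
      ext x; simp [lastPrimitive]
    rw [this]; exact Submodule.smul_mem _ _ ih

lemma iterate_lastPrimitive_mem {n : ℕ} {q : E d × ℝ → ℝ} (hq : q ∈ conePoly d n) (k : ℕ) :
    lastPrimitive^[k] q ∈ conePoly d (n + k) := by
  induction k with
  | zero => exact hq
  | succ k ih =>
    rw [Function.iterate_succ_apply']
    exact lastPrimitive_mem ih

lemma lastDeriv_iterate_lastPrimitive {n : ℕ} {q : E d × ℝ → ℝ} (hq : q ∈ conePoly d n)
    (k j : ℕ) : lastDeriv k (lastPrimitive^[k + j] q) = lastPrimitive^[j] q := by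
  induction k with
  | zero => simp [lastDeriv_zero]
  | succ k ih =>
    rw [lastDeriv_succ', show k + 1 + j = (k + j) + 1 by ring, Function.iterate_succ_apply',
      lastDeriv_one_lastPrimitive (continuous_conePoly (iterate_lastPrimitive_mem hq _)), ih]

/-- At least one primitive survives the `k` differentiations, and it vanishes at `t = 1`. -/
lemma lastDeriv_iterate_lastPrimitive_rim {n : ℕ} {q : E d × ℝ → ℝ} (hq : q ∈ conePoly d n)
    {k s : ℕ} (h : k < s) (x : E d) : lastDeriv k (lastPrimitive^[s] q) (x, 1) = 0 := by
  obtain ⟨j, rfl⟩ := Nat.exists_eq_add_of_lt h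
  rw [add_assoc, lastDeriv_iterate_lastPrimitive hq, Function.iterate_succ_apply',
    lastPrimitive_apply_one]

lemma lastDeriv_iterate_lastPrimitive_polyVal {m k : ℕ} {Y : MvPolynomial (Fin d) ℝ} {n : ℕ}
    (hY : Y ∈ solidHarmonics d n) (h : m < k) :
    lastDeriv k (lastPrimitive^[m] fun p : E d × ℝ => polyVal Y p.1) = 0 := by
  have hq : (fun p : E d × ℝ => polyVal Y p.1) ∈ conePoly d n := by
    simpa using monomial_mem_conePoly (j := 0) (by omega) hY
  obtain ⟨j, rfl⟩ := Nat.exists_eq_add_of_lt h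
  induction j with
  | zero =>
    rw [add_zero, lastDeriv_succ]
    have := lastDeriv_iterate_lastPrimitive hq m 0
    rw [add_zero] at this
    rw [this]
    ext p
    simp [lastDeriv]
  | succ j ih =>
    rw [show m + (j + 1) + 1 = (m + j + 1) + 1 by ring, lastDeriv_succ, ih (by omega)]
    ext p
    simp [lastDeriv]

lemma iterate_lastPrimitive_polyVal (m : ℕ) (Y : MvPolynomial (Fin d) ℝ) (p : E d × ℝ) :
    lastPrimitive^[m] (fun p : E d × ℝ => polyVal Y p.1) p =
      (p.2 - 1) ^ m / m.factorial * polyVal Y p.1 := by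
  induction m generalizing p with
  | zero => simp
  | succ m ih =>
    rw [Function.iterate_succ_apply']
    simp only [lastPrimitive, ih]
    rw [intervalIntegral.integral_mul_const, intervalIntegral.integral_div,
      intervalIntegral.integral_comp_sub_right (fun v => v ^ m), integral_pow, Nat.factorial_succ]
    push_cast
    rw [sub_self, zero_pow (Nat.succ_ne_zero m), sub_zero, div_div]

/-- Cauchy's formula for repeated integration, read off from Taylor's formula at `1`: the Taylor
polynomial of `J^s q` vanishes, so only the integral remainder is left. Reversing the interval and
replacing `t - v` by `v - t` produces `(-1)^s`. -/
lemma iterate_lastPrimitive_eq_integral {n : ℕ} {q : E d × ℝ → ℝ} (hq : q ∈ conePoly d n)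
    {s : ℕ} (hs : 1 ≤ s) (x : E d) (t : ℝ) :
    lastPrimitive^[s] q (x, t) =
      (-1) ^ s * ∫ v in t..1, (v - t) ^ (s - 1) / ((s - 1).factorial : ℝ) * q (x, v) := by
  obtain ⟨k, rfl⟩ : ∃ k, s = k + 1 := ⟨s - 1, by omega⟩
  -- For `t = 1` the interval is a point, where derivatives within it are not unique.
  rcases eq_or_ne 1 t with rfl | ht
  · rw [Function.iterate_succ_apply', lastPrimitive_apply_one]; simp
  have hmem := iterate_lastPrimitive_mem hq (k + 1)
  have hu := uniqueDiffOn_uIcc ht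
  have hd (j : ℕ) {v : ℝ} (hv : v ∈ Set.uIcc 1 t) :
      iteratedDerivWithin j (fun τ => lastPrimitive^[k + 1] q (x, τ)) (Set.uIcc 1 t) v =
        lastDeriv j (lastPrimitive^[k + 1] q) (x, v) :=
    iteratedDerivWithin_eq_iteratedDeriv hu (contDiff_conePoly hmem x j).contDiffAt hv
  have h := taylor_integral_remainder (x₀ := 1) (x := t) (n := k)
    (contDiff_conePoly hmem x (k + 1 : ℕ)).contDiffOn
  rw [taylor_within_apply, Finset.sum_eq_zero, sub_zero] at h
  · rw [h, intervalIntegral.integral_symm t 1, ← intervalIntegral.integral_neg,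
      ← intervalIntegral.integral_const_mul]
    refine intervalIntegral.integral_congr fun v hv => ?_
    have h1 := congrFun (lastDeriv_iterate_lastPrimitive hq (k + 1) 0) (x, v)
    rw [add_zero, Function.iterate_zero, id] at h1
    rw [hd _ (Set.uIcc_comm t 1 ▸ hv), h1, ← neg_sub v t, neg_pow, smul_eq_mul, pow_succ,
      add_tsub_cancel_right]
    ring
  · intro j hj
    rw [hd j Set.left_mem_uIcc, lastDeriv_iterate_lastPrimitive_rim hq (Finset.mem_range.1 hj),
      smul_zero]

lemma eq_zero_of_lastDeriv_eq_zero {n : ℕ} {q : E d × ℝ → ℝ} (hq : q ∈ conePoly d n) {s : ℕ}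
    (hs : lastDeriv s q = 0) (hrim : ∀ k < s, ∀ x, lastDeriv k q (x, 1) = 0) : q = 0 := by
  induction s with
  | zero => rwa [lastDeriv_zero] at hs
  | succ s ih =>
    refine ih ?_ fun k hk => hrim k (by omega)
    ext ⟨x, t⟩
    have hm := (lastDeriv_mem hq s).1
    have := is_const_of_deriv_eq_zero (f := fun τ => lastDeriv s q (x, τ))
      ((contDiff_conePoly hm x 1).differentiable one_ne_zero) (fun τ => by
        have := congrFun hs (x, τ)
        rw [lastDeriv_succ] at this
        simpa [lastDeriv] using this) t 1
    rw [this]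
    exact hrim s (by omega) x

/-! ### Values on the rim -/

lemma integrable_sphere {g : Sph d → ℝ} (hg : Continuous g) :
    Integrable g (sphereMeasure d) :=
  hg.integrable_of_hasCompactSupport (HasCompactSupport.of_compactSpace g)

lemma continuous_polyVal_sphere (Y : MvPolynomial (Fin d) ℝ) :
    Continuous fun ξ : Sph d => polyVal Y (ξ : E d) :=
  (continuous_polyVal Y).comp continuous_subtype_val

lemma eq_zero_of_integral_sq_eq_zero {g : Sph d → ℝ} (hg : Continuous g)
    (h : ∫ ξ, g ξ * g ξ ∂(sphereMeasure d) = 0) : g = 0 := by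
  have h1 := (integral_eq_zero_iff_of_nonneg (fun ξ => mul_self_nonneg (g ξ))
    (integrable_sphere (hg.mul hg))).1 h
  have h2 := (Continuous.ae_eq_iff_eq (sphereMeasure d) (hg.mul hg) continuous_zero).1 h1
  ext ξ
  exact mul_self_eq_zero.1 (congrFun h2 ξ)

lemma polyVal_eq_zero_of_sphere {m : ℕ} (hd : 1 ≤ d) {Y : MvPolynomial (Fin d) ℝ}
    (hY : Y ∈ solidHarmonics d m) (h : ∀ ξ : Sph d, polyVal Y (ξ : E d) = 0) :
    polyVal Y = 0 := by
  have := nontrivial_E hd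
  ext x
  obtain ⟨r, ξ, rfl⟩ : ∃ (r : ℝ) (ξ : Sph d), x = r • (ξ : E d) := by
    rcases eq_or_ne x 0 with rfl | hx
    · obtain ⟨ξ, hξ⟩ := NormedSpace.sphere_nonempty (E := E d) (x := 0) (r := 1) |>.2 zero_le_one
      exact ⟨0, ⟨ξ, hξ⟩, by simp⟩
    · exact ⟨‖x‖, ⟨‖x‖⁻¹ • x, by simp [norm_smul, hx]⟩, by simp [smul_smul, hx]⟩
  rw [polyVal_smul hY.1, h, mul_zero]; rfl

lemma polyVal_eq_zero_of_integral_sq {m : ℕ} (hd : 1 ≤ d) {Y : MvPolynomial (Fin d) ℝ}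
    (hY : Y ∈ solidHarmonics d m)
    (h : ∫ ξ : Sph d, polyVal Y (ξ : E d) * polyVal Y (ξ : E d) ∂(sphereMeasure d) = 0) :
    polyVal Y = 0 :=
  polyVal_eq_zero_of_sphere hd hY
    (congrFun (eq_zero_of_integral_sq_eq_zero (continuous_polyVal_sphere Y) h))

lemma integral_sum_solidHarmonics_mul (hd : 1 ≤ d) {Y : ℕ → MvPolynomial (Fin d) ℝ}
    (hY : ∀ m, Y m ∈ solidHarmonics d m) {k : ℕ} {Z : MvPolynomial (Fin d) ℝ}
    (hZ : Z ∈ solidHarmonics d k) {n : ℕ} (hk : k ≤ n) :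
    ∫ ξ : Sph d, (∑ m ∈ Finset.range (n + 1), polyVal (Y m) (ξ : E d)) * polyVal Z (ξ : E d)
      ∂(sphereMeasure d) =
    ∫ ξ : Sph d, polyVal (Y k) (ξ : E d) * polyVal Z (ξ : E d) ∂(sphereMeasure d) := by
  simp_rw [Finset.sum_mul]
  rw [integral_finsetSum, Finset.sum_eq_single k]
  · exact fun m _ hm => integral_sphere_solidHarmonics_mul hd hm (hY m) hZ
  · intro h; exact absurd (Finset.mem_range.2 (by omega)) h
  · exact fun m _ => integrable_sphere
      ((continuous_polyVal_sphere _).mul (continuous_polyVal_sphere _))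

lemma conePoly_rim {n : ℕ} {q : E d × ℝ → ℝ} (hq : q ∈ conePoly d n) :
    ∃ Y : ℕ → MvPolynomial (Fin d) ℝ, (∀ m, Y m ∈ solidHarmonics d m) ∧
      ∀ x, q (x, 1) = ∑ m ∈ Finset.range (n + 1), polyVal (Y m) x := by
  obtain ⟨c, hc, rfl⟩ := conePoly_normal_form hq
  refine ⟨fun m => ∑ j ∈ Finset.range (n + 1), c j m, fun m => sum_mem fun j _ => hc j m,
    fun x => ?_⟩
  beta_reduce
  rw [Finset.sum_comm]
  simp [polyVal]

lemma conePoly_rim_eq_zero {n : ℕ} (hd : 1 ≤ d) {q : E d × ℝ → ℝ} (hq : q ∈ conePoly d n)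
    (h : ∀ ξ : Sph d, q ((ξ : E d), 1) = 0) (x : E d) : q (x, 1) = 0 := by
  obtain ⟨Y, hY, hqY⟩ := conePoly_rim hq
  rw [hqY]
  refine Finset.sum_eq_zero fun k hk => ?_
  have h1 := integral_sum_solidHarmonics_mul hd hY (hY k) (Finset.mem_range_succ_iff.1 hk)
  simp_rw [← hqY, h, zero_mul, integral_zero] at h1
  exact congrFun (polyVal_eq_zero_of_integral_sq hd (hY k) h1.symm) x

/-- Each component of degree below `n` is orthogonal to itself, hence zero; only the top one
remains. -/
lemma conePoly_rim_solidHarmonic {n : ℕ} (hd : 1 ≤ d) {q : E d × ℝ → ℝ} (hq : q ∈ conePoly d n)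
    (h : ∀ k < n, ∀ Z ∈ solidHarmonics d k,
      ∫ ξ : Sph d, q ((ξ : E d), 1) * polyVal Z (ξ : E d) ∂(sphereMeasure d) = 0) :
    ∃ Y ∈ solidHarmonics d n, ∀ x, q (x, 1) = polyVal Y x := by
  obtain ⟨Y, hY, hqY⟩ := conePoly_rim hq
  refine ⟨Y n, hY n, fun x => ?_⟩
  rw [hqY, Finset.sum_range_succ, Finset.sum_eq_zero, zero_add]
  intro k hk
  have hk := Finset.mem_range.1 hk
  have h1 := integral_sum_solidHarmonics_mul hd hY (hY k) hk.le
  simp_rw [← hqY, h k hk _ (hY k)] at h1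
  exact congrFun (polyVal_eq_zero_of_integral_sq hd (hY k) h1.symm) x

/-- At `(tξ, t)` the normal form becomes `∑ t^(j+m) c_{jm}(ξ)`. Integration against `c_{ik}` selects
`m = k` and leaves a polynomial in `t` that vanishes on `(0,1]`; its coefficient of index `i` is the
squared norm of `c_{ik}`. -/
lemma conePoly_eq_zero_of_cone {n : ℕ} (hd : 1 ≤ d) {q : E d × ℝ → ℝ} (hq : q ∈ conePoly d n)
    (h : ∀ t ∈ Set.Ioc (0 : ℝ) 1, ∀ ξ : Sph d, q (t • (ξ : E d), t) = 0) : q = 0 := by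
  obtain ⟨c, hc, rfl⟩ := conePoly_normal_form hq
  suffices H : ∀ k ∈ Finset.range (n + 1), ∀ j ∈ Finset.range (n + 1), polyVal (c j k) = 0 by
    ext p
    exact Finset.sum_eq_zero fun j hj => Finset.sum_eq_zero fun k hk => by simp [H k hk j hj]
  intro k hk i hi
  set a : ℕ → ℝ := fun j => ∫ ξ : Sph d, polyVal (c j k) (ξ : E d) * polyVal (c i k) (ξ : E d)
    ∂(sphereMeasure d) with ha
  have h1 (t : ℝ) (ht : t ∈ Set.Ioc (0 : ℝ) 1) : ∑ j ∈ Finset.range (n + 1), a j * t ^ j = 0 := by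
    -- The factor `t ^ m` from homogeneity is absorbed into the harmonic, so that
    -- `integral_sum_solidHarmonics_mul` applies for each `j`.
    have hI : ∫ ξ : Sph d, (∑ j ∈ Finset.range (n + 1), t ^ j *
        ∑ m ∈ Finset.range (n + 1), polyVal (t ^ m • c j m) (ξ : E d)) * polyVal (c i k) (ξ : E d)
        ∂(sphereMeasure d) = 0 := by
      rw [← integral_zero (Sph d) ℝ (μ := sphereMeasure d)]
      congr 1
      ext ξ
      have := h t ht ξ
      simp only [polyVal_smul (hc _ _).1] at this
      rw [mul_eq_zero]
      left
      rw [← this]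
      simp [polyVal, Finset.mul_sum]
    simp_rw [Finset.sum_mul, mul_assoc] at hI
    rw [integral_finsetSum] at hI
    · simp_rw [integral_const_mul] at hI
      have hI' : t ^ k * ∑ j ∈ Finset.range (n + 1), a j * t ^ j = 0 := by
        rw [← hI, Finset.mul_sum]
        refine Finset.sum_congr rfl fun j _ => ?_
        rw [integral_sum_solidHarmonics_mul hd (fun m => Submodule.smul_mem _ (t ^ m) (hc j m))
          (hc i k) (Finset.mem_range_succ_iff.1 hk)]
        simp only [polyVal, MvPolynomial.smul_eval, mul_assoc, integral_const_mul, ha]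
        ring
      exact (mul_eq_zero.1 hI').resolve_left (pow_ne_zero _ ht.1.ne')
    · intro j _
      have h2 (m : ℕ) := continuous_polyVal_sphere (t ^ m • c j m)
      have h3 := continuous_polyVal_sphere (c i k)
      exact integrable_sphere (by fun_prop)
  have h2 : (∑ j ∈ Finset.range (n + 1), Polynomial.C (a j) * Polynomial.X ^ j) = 0 := by
    refine Polynomial.eq_zero_of_infinite_isRoot _
      ((Set.Ioc_infinite (zero_lt_one' ℝ)).mono fun t ht => ?_)
    simpa [Polynomial.IsRoot, Polynomial.eval_finsetSum] using h1 t ht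
  have h3 := congrArg (fun P => Polynomial.coeff P i) h2
  simp only [Polynomial.finsetSum_coeff, Polynomial.coeff_C_mul_X_pow, Polynomial.coeff_zero,
    Finset.sum_ite_eq, hi, if_true] at h3
  exact polyVal_eq_zero_of_integral_sq hd (hc i k) h3

/-! ### The measure on the cone -/

/-- Both densities are positive for `t > 0`, including `t = 1`, since the second exponent is `0`.
The null sets are thus those of the product measure. -/
lemma ae_coneWeighted_iff {α : ℝ} {P : E d × ℝ → Prop} (hP : MeasurableSet {p | P p}) :
    (∀ᵐ p ∂(coneWeighted d α 0), P p) ↔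
      ∀ᵐ q ∂((sphereMeasure d).prod (volume.restrict (Set.Ioc (0 : ℝ) 1))),
        P (q.2 • (q.1 : E d), q.2) := by
  have hmap : Measurable fun q : Sph d × ℝ => (q.2 • (q.1 : E d), q.2) := by
    refine Continuous.measurable ?_
    fun_prop
  have hpos : ∀ᵐ q ∂((sphereMeasure d).prod (volume.restrict (Set.Ioc (0 : ℝ) 1))),
      0 < q.2 :=
    Measure.quasiMeasurePreserving_snd.ae
      ((ae_restrict_mem measurableSet_Ioc).mono fun t ht => ht.1)
  unfold coneWeighted coneMeasure
  rw [ae_withDensity_iff (by fun_prop), ae_map_iff hmap.aemeasurable, ae_withDensity_iff (by fun_prop)]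
  · refine Filter.eventually_congr ?_
    filter_upwards [hpos] with q hq
    have h1 : ENNReal.ofReal (q.2 ^ (d - 1)) ≠ 0 := by simp; positivity
    have h2 : ENNReal.ofReal (q.2 ^ α * (1 - q.2) ^ (0 : ℝ)) ≠ 0 := by simp; positivity
    simp only [ne_eq, h1, h2, not_false_eq_true, forall_const]
  · have hm : Measurable fun p : E d × ℝ => ENNReal.ofReal (p.2 ^ α * (1 - p.2) ^ (0 : ℝ)) := by
      fun_prop
    exact (hm (measurableSet_singleton 0).compl).imp hP

lemma isFiniteMeasure_coneWeighted (hd : 1 ≤ d) {α : ℝ} (hα : -(d : ℝ) < α) :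
    IsFiniteMeasure (coneWeighted d α 0) := by
  constructor
  unfold coneWeighted coneMeasure
  have hmap : Measurable fun q : Sph d × ℝ => (q.2 • (q.1 : E d), q.2) := by
    refine Continuous.measurable ?_
    fun_prop
  rw [withDensity_apply _ MeasurableSet.univ, Measure.restrict_univ,
    lintegral_map (by fun_prop) hmap, lintegral_withDensity_eq_lintegral_mul _ (by fun_prop)
      (by fun_prop)]
  simp only [Real.rpow_zero, mul_one, Pi.mul_apply]
  have h1 := lintegral_prod_mul (μ := sphereMeasure d) (ν := volume.restrict (Set.Ioc (0 : ℝ) 1))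
    (f := fun _ => 1) (g := fun t => ENNReal.ofReal (t ^ (d - 1)) * ENNReal.ofReal (t ^ α))
    aemeasurable_const (by fun_prop)
  simp only [one_mul] at h1
  rw [h1, lintegral_one]
  refine ENNReal.mul_lt_top (measure_lt_top _ _) ?_
  -- The condition `α > -d` says precisely that the exponent exceeds `-1`.
  have h2 : IntegrableOn (fun t : ℝ => t ^ ((d - 1 : ℕ) + α)) (Set.Ioc 0 1) := by
    rw [← intervalIntegrable_iff_integrableOn_Ioc_of_le zero_le_one]
    refine intervalIntegral.intervalIntegrable_rpow' ?_
    rw [Nat.cast_sub hd]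
    push_cast
    linarith
  refine lt_of_eq_of_lt (setLIntegral_congr_fun measurableSet_Ioc fun t ht => ?_)
    h2.lintegral_lt_top
  rw [← ENNReal.ofReal_mul (by have := ht.1; positivity), Real.rpow_add ht.1, Real.rpow_natCast]

lemma ae_coneWeighted_bounds (α : ℝ) :
    ∀ᵐ p ∂(coneWeighted d α 0), ‖p.1‖ ≤ 1 ∧ 0 < p.2 ∧ p.2 ≤ 1 := by
  rw [ae_coneWeighted_iff]
  · refine Measure.quasiMeasurePreserving_snd.ae (p := fun t : ℝ => 0 < t ∧ t ≤ 1)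
      (ae_restrict_mem measurableSet_Ioc) |>.mono fun q hq => ?_
    simpa [norm_smul, abs_of_pos hq.1, hq.1] using hq.2
  · have h1 : Measurable fun p : E d × ℝ => ‖p.1‖ := by fun_prop
    exact (h1 measurableSet_Iic).inter (measurable_snd measurableSet_Ioc)

/-- Fubini and continuity used twice: first in `t` for almost every `ξ`, then in `ξ` for each fixed
`t`. -/
lemma eq_zero_on_cone_of_ae {α : ℝ} {q : E d × ℝ → ℝ} (hq : Continuous q)
    (h : ∀ᵐ p ∂(coneWeighted d α 0), q p = 0) :
    ∀ t ∈ Set.Ioc (0 : ℝ) 1, ∀ ξ : Sph d, q (t • (ξ : E d), t) = 0 := by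
  rw [ae_coneWeighted_iff (P := fun p => q p = 0) (hq.measurable (measurableSet_singleton 0))] at h
  have h1 := Measure.ae_ae_of_ae_prod h
  have h2 : ∀ᵐ ξ : Sph d ∂(sphereMeasure d), ∀ t ∈ Set.Ioc (0 : ℝ) 1, q (t • (ξ : E d), t) = 0 := by
    filter_upwards [h1] with ξ hξ
    have hc : Continuous fun t : ℝ => q (t • (ξ : E d), t) := by fun_prop
    exact Measure.eqOn_Ioc_of_ae_eq volume (g := fun _ => (0 : ℝ)) hξ hc.continuousOn
      continuousOn_const
  intro t ht ξ
  have hc : Continuous fun ξ : Sph d => q (t • (ξ : E d), t) := by fun_prop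
  have h3 : (fun ξ : Sph d => q (t • (ξ : E d), t)) =ᵐ[sphereMeasure d] 0 := by
    filter_upwards [h2] with ξ hξ using hξ t ht
  exact congrFun ((Continuous.ae_eq_iff_eq _ hc continuous_zero).1 h3) ξ

lemma memLp_coneWeighted (hd : 1 ≤ d) {α : ℝ} (hα : -(d : ℝ) < α) {q : E d × ℝ → ℝ}
    (hq : Continuous q) : MemLp q 2 (coneWeighted d α 0) := by
  have := isFiniteMeasure_coneWeighted hd hα
  obtain ⟨C, hC⟩ := ((isCompact_closedBall (0 : E d) 1).prod
    (isCompact_Icc (a := (0 : ℝ)) (b := 1))).exists_bound_of_continuousOn hq.continuousOn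
  refine MemLp.of_bound hq.aestronglyMeasurable C ?_
  filter_upwards [ae_coneWeighted_bounds α] with p hp
  exact hC p ⟨by simpa using hp.1, hp.2.1.le, hp.2.2⟩

lemma memLp_sphere {g : Sph d → ℝ} (hg : Continuous g) : MemLp g 2 (sphereMeasure d) :=
  hg.memLp_of_hasCompactSupport (HasCompactSupport.of_compactSpace g)

/-! ### Existence and uniqueness of orthogonal projections -/

/-- Definiteness makes `W → W*` injective, hence bijective in finite dimension, and `p` represents
the functional `B f`. Bilinearity is asked only on `L`, because an integral form need not be
additive on functions whose products are not integrable. -/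
lemma existsUnique_isOrthProj {V : Type*} [AddCommGroup V] [Module ℝ V] {B : V → V → ℝ}
    {W : Submodule ℝ V} [FiniteDimensional ℝ W] {f : V} (L : Submodule ℝ V) (hWL : W ≤ L)
    (hf : f ∈ L) (hsymm : ∀ p q, B p q = B q p)
    (hadd : ∀ p ∈ L, ∀ q ∈ L, ∀ r ∈ L, B (p + q) r = B p r + B q r)
    (hsmul : ∀ (a : ℝ), ∀ p ∈ L, ∀ r ∈ L, B (a • p) r = a * B p r)
    (hpos : ∀ p ∈ W, B p p = 0 → p = 0) : ∃! p, IsOrthProj B W f p := by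
  let b : L →ₗ[ℝ] L →ₗ[ℝ] ℝ := LinearMap.mk₂ ℝ (fun p q : L => B p q)
    (fun p q r => hadd p p.2 q q.2 r r.2) (fun a p r => hsmul a p p.2 r r.2)
    (fun p q r => by
      rw [hsymm p, hsymm p, hsymm p]; exact hadd q q.2 r r.2 p p.2)
    (fun a p r => by
      rw [hsymm p, hsymm p]; exact hsmul a r r.2 p p.2)
  let i : W →ₗ[ℝ] L := Submodule.inclusion hWL
  let T : W →ₗ[ℝ] Module.Dual ℝ W := b.compl₁₂ i i
  have hT : Function.Injective T := by
    rw [← LinearMap.ker_eq_bot, LinearMap.ker_eq_bot']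
    intro p hp
    exact Subtype.ext (hpos p p.2 (LinearMap.congr_fun hp p))
  have hT' : Function.Surjective T :=
    (LinearMap.injective_iff_surjective_of_finrank_eq_finrank
      (Subspace.dual_finrank_eq (K := ℝ) (V := W)).symm).1 hT
  obtain ⟨p, hp⟩ := hT' ((b ⟨f, hf⟩).comp i)
  refine ⟨p, ⟨p.2, fun q hq => (LinearMap.congr_fun hp ⟨q, hq⟩).symm⟩, fun p' hp' => ?_⟩
  have : (⟨p', hp'.1⟩ : W) = p := hT (by
    rw [hp]
    ext q
    exact (hp'.2 q q.2).symm)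
  exact congrArg Subtype.val this

lemma isOrthProj_orthProj {V : Type*} [AddCommGroup V] [Module ℝ V] {B : V → V → ℝ}
    {W : Submodule ℝ V} {f : V} (h : ∃! p, IsOrthProj B W f p) :
    IsOrthProj B W f (orthProj B W f) := by
  unfold orthProj
  rw [dif_pos h.exists]
  exact h.exists.choose_spec

/-- The space of square integrable functions. -/
def squareIntegrable {X : Type*} [MeasurableSpace X] (μ : Measure X) : Submodule ℝ (X → ℝ) where
  carrier := {g | MemLp g 2 μ}
  zero_mem' := MemLp.zero
  add_mem' := MemLp.add
  smul_mem' a _ hg := hg.const_smul a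

lemma integral_add_mul_of_memLp {X : Type*} [MeasurableSpace X] {μ : Measure X} {p q r : X → ℝ}
    (hp : MemLp p 2 μ) (hq : MemLp q 2 μ) (hr : MemLp r 2 μ) :
    ∫ x, (p + q) x * r x ∂μ = ∫ x, p x * r x ∂μ + ∫ x, q x * r x ∂μ := by
  simp_rw [Pi.add_apply, add_mul]
  exact integral_add (MemLp.integrable_mul hp hr) (MemLp.integrable_mul hq hr)

lemma existsUnique_isOrthProj_integral {X : Type*} [MeasurableSpace X] {μ : Measure X} {c : ℝ}
    {W : Submodule ℝ (X → ℝ)} [FiniteDimensional ℝ W] (hc : 0 < c)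
    (hW : ∀ p ∈ W, MemLp p 2 μ) (hpos : ∀ p ∈ W, p =ᵐ[μ] 0 → p = 0) {f : X → ℝ}
    (hf : MemLp f 2 μ) :
    ∃! p, IsOrthProj (fun g h => c * ∫ x, g x * h x ∂μ) W f p := by
  refine existsUnique_isOrthProj (squareIntegrable μ) hW hf (fun p q => by simp_rw [mul_comm (p _)])
    (fun p hp q hq r hr => ?_) (fun a p hp r hr => ?_) (fun p hp h => hpos p hp ?_)
  · rw [integral_add_mul_of_memLp hp hq hr, mul_add]
  · simp_rw [Pi.smul_apply, smul_eq_mul, mul_assoc, integral_const_mul]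
    ring
  · have h1 := (mul_eq_zero.1 h).resolve_left hc.ne'
    rw [integral_eq_zero_iff_of_nonneg (fun x => mul_self_nonneg (p x))
      (MemLp.integrable_mul (hW p hp) (hW p hp))] at h1
    filter_upwards [h1] with x hx using mul_self_eq_zero.1 hx

lemma mem_orthPolys {B : (E d × ℝ → ℝ) → (E d × ℝ → ℝ) → ℝ} {n : ℕ}
    (hadd : ∀ p ∈ conePoly d n, ∀ q ∈ conePoly d n, ∀ r ∈ conePoly d n,
      B (p + q) r = B p r + B q r)
    (hsmul : ∀ (a : ℝ), ∀ p ∈ conePoly d n, ∀ r ∈ conePoly d n, B (a • p) r = a * B p r)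
    {P : E d × ℝ → ℝ} : P ∈ orthPolys d B n ↔ IsOrthPoly d B n P := by
  refine ⟨fun h => ?_, fun h => Submodule.subset_span h⟩
  induction h using Submodule.span_induction with
  | mem P hP => exact hP
  | zero =>
    refine ⟨zero_mem _, fun k hk Q hQ => ?_⟩
    simpa using hsmul 0 0 (zero_mem _) Q (conePoly_mono hk.le hQ)
  | add p q _ _ hp hq =>
    refine ⟨add_mem hp.1 hq.1, fun k hk Q hQ => ?_⟩
    rw [hadd p hp.1 q hq.1 Q (conePoly_mono hk.le hQ), hp.2 k hk Q hQ, hq.2 k hk Q hQ, add_zero]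
  | smul a p _ hp =>
    refine ⟨Submodule.smul_mem _ a hp.1, fun k hk Q hQ => ?_⟩
    rw [hsmul a p hp.1 Q (conePoly_mono hk.le hQ), hp.2 k hk Q hQ, mul_zero]

lemma omega_pos (hd : 1 ≤ d) : 0 < omega d := by
  have : (0 : ℝ) < d := by exact_mod_cast hd
  have := Real.Gamma_pos_of_pos (half_pos this)
  unfold omega
  positivity

lemma existsUnique_sphereProj (hd : 1 ≤ d) (n : ℕ) {f : Sph d → ℝ}
    (hf : MemLp f 2 (sphereMeasure d)) :
    ∃! p, IsOrthProj (sphereInner d) (sphericalHarmonics d n) f p := by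
  have hW : ∀ p ∈ sphericalHarmonics d n, Continuous p := by
    rintro _ ⟨Y, -, rfl⟩
    exact continuous_polyVal_sphere Y
  exact existsUnique_isOrthProj_integral (one_div_pos.2 (omega_pos hd))
    (fun p hp => memLp_sphere (hW p hp))
    (fun p hp h => (Continuous.ae_eq_iff_eq _ (hW p hp) continuous_zero).1 h) hf

lemma coneNormConst_pos (hd : 1 ≤ d) {α : ℝ} (hα : -(d : ℝ) < α) : 0 < coneNormConst d α 0 := by
  have h1 := omega_pos hd
  have h2 : 0 < Real.Gamma (α + d) := Real.Gamma_pos_of_pos (by linarith)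
  have h3 : 0 < Real.Gamma (α + d + 0 + 1) := Real.Gamma_pos_of_pos (by linarith)
  have h4 : 0 < Real.Gamma (0 + 1) := Real.Gamma_pos_of_pos (by norm_num)
  unfold coneNormConst
  positivity

lemma orthPolys_le (B : (E d × ℝ → ℝ) → (E d × ℝ → ℝ) → ℝ) (n : ℕ) :
    orthPolys d B n ≤ conePoly d n :=
  Submodule.span_le.2 fun _ h => h.1

instance finiteDimensional_orthPolys (B : (E d × ℝ → ℝ) → (E d × ℝ → ℝ) → ℝ) (n : ℕ) :
    FiniteDimensional ℝ (orthPolys d B n) :=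
  Submodule.finiteDimensional_of_le (orthPolys_le B n)

lemma conePoly_eq_zero_of_ae (hd : 1 ≤ d) {α : ℝ} {n : ℕ} {q : E d × ℝ → ℝ}
    (hq : q ∈ conePoly d n) (h : q =ᵐ[coneWeighted d α 0] 0) : q = 0 :=
  conePoly_eq_zero_of_cone hd hq (eq_zero_on_cone_of_ae (continuous_conePoly hq) h)

lemma existsUnique_coneProj (hd : 1 ≤ d) {α : ℝ} (hα : -(d : ℝ) < α) (n : ℕ) {f : E d × ℝ → ℝ}
    (hf : MemLp f 2 (coneWeighted d α 0)) :
    ∃! p, IsOrthProj (coneInner d α 0) (orthPolys d (coneInner d α 0) n) f p :=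
  existsUnique_isOrthProj_integral (coneNormConst_pos hd hα)
    (fun _ hp => memLp_coneWeighted hd hα (continuous_conePoly (orthPolys_le _ _ hp)))
    (fun _ hp h => conePoly_eq_zero_of_ae hd (orthPolys_le _ _ hp) h) hf

lemma mem_orthPolys_coneInner (hd : 1 ≤ d) {α : ℝ} (hα : -(d : ℝ) < α) {n : ℕ}
    {P : E d × ℝ → ℝ} :
    P ∈ orthPolys d (coneInner d α 0) n ↔ IsOrthPoly d (coneInner d α 0) n P := by
  have hL {p : E d × ℝ → ℝ} (hp : p ∈ conePoly d n) : MemLp p 2 (coneWeighted d α 0) :=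
    memLp_coneWeighted hd hα (continuous_conePoly hp)
  refine mem_orthPolys (fun p hp q hq r hr => ?_) (fun a p hp r hr => ?_) <;> unfold coneInner
  · rw [integral_add_mul_of_memLp (hL hp) (hL hq) (hL hr), mul_add]
  · simp_rw [Pi.smul_apply, smul_eq_mul, mul_assoc, integral_const_mul]
    ring

/-! ### The Sobolev inner product on polynomials -/

lemma sobolevInner_conePoly_right (β : ℝ) (s : ℕ) (lam : ℕ → ℝ) (f : E d × ℝ → ℝ) {n : ℕ}
    {q : E d × ℝ → ℝ} (hq : q ∈ conePoly d n) :
    sobolevInner d β s lam f q =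
      1 / omega d * (∫ p, tDeriv s f p * lastDeriv s q p ∂(coneWeighted d (β + s) 0)) +
      ∑ k ∈ Finset.range s, lam k / omega d *
        ∫ ξ, rimDeriv k f ξ * lastDeriv k q ((ξ : E d), 1) ∂(sphereMeasure d) := by
  unfold sobolevInner
  simp_rw [rimDeriv_eq_lastDeriv hq]
  congr 2
  refine integral_congr_ae ?_
  filter_upwards [ae_coneWeighted_bounds (β + s)] with p hp
  rw [tDeriv_eq_lastDeriv hq s hp.2.2]

lemma sobolevInner_conePoly (β : ℝ) (s : ℕ) (lam : ℕ → ℝ) {n n' : ℕ} {p q : E d × ℝ → ℝ}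
    (hp : p ∈ conePoly d n) (hq : q ∈ conePoly d n') :
    sobolevInner d β s lam p q =
      1 / omega d * (∫ z, lastDeriv s p z * lastDeriv s q z ∂(coneWeighted d (β + s) 0)) +
      ∑ k ∈ Finset.range s, lam k / omega d *
        ∫ ξ : Sph d, lastDeriv k p ((ξ : E d), 1) * lastDeriv k q ((ξ : E d), 1)
          ∂(sphereMeasure d) := by
  rw [sobolevInner_conePoly_right β s lam p hq]
  simp_rw [rimDeriv_eq_lastDeriv hp]
  congr 2
  refine integral_congr_ae ?_
  filter_upwards [ae_coneWeighted_bounds (β + s)] with z hz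
  rw [tDeriv_eq_lastDeriv hp s hz.2.2]

variable {β : ℝ} {s : ℕ} {lam : ℕ → ℝ} {n : ℕ}

lemma continuous_rim_lastDeriv {p : E d × ℝ → ℝ} (hp : p ∈ conePoly d n) (k : ℕ) :
    Continuous fun ξ : Sph d => lastDeriv k p ((ξ : E d), 1) := by
  have := continuous_conePoly (lastDeriv_mem hp k).1
  fun_prop

lemma memLp_lastDeriv (hd : 1 ≤ d) (hβ : -(d : ℝ) < β + s) {p : E d × ℝ → ℝ}
    (hp : p ∈ conePoly d n) (k : ℕ) : MemLp (lastDeriv k p) 2 (coneWeighted d (β + s) 0) :=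
  memLp_coneWeighted hd hβ (continuous_conePoly (lastDeriv_mem hp k).1)

lemma sobolevInner_add_left (hd : 1 ≤ d) (hβ : -(d : ℝ) < β + s) {p q r : E d × ℝ → ℝ}
    (hp : p ∈ conePoly d n) (hq : q ∈ conePoly d n) (hr : r ∈ conePoly d n) :
    sobolevInner d β s lam (p + q) r =
      sobolevInner d β s lam p r + sobolevInner d β s lam q r := by
  rw [sobolevInner_conePoly β s lam (add_mem hp hq) hr, sobolevInner_conePoly β s lam hp hr,
    sobolevInner_conePoly β s lam hq hr]
  simp_rw [lastDeriv_add hp hq]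
  rw [integral_add_mul_of_memLp (memLp_lastDeriv hd hβ hp s) (memLp_lastDeriv hd hβ hq s)
    (memLp_lastDeriv hd hβ hr s), mul_add, add_add_add_comm, ← Finset.sum_add_distrib]
  congr 1
  refine Finset.sum_congr rfl fun k _ => ?_
  rw [← mul_add]
  exact congrArg _ (integral_add_mul_of_memLp (memLp_sphere (continuous_rim_lastDeriv hp k))
    (memLp_sphere (continuous_rim_lastDeriv hq k)) (memLp_sphere (continuous_rim_lastDeriv hr k)))

lemma sobolevInner_smul_left (a : ℝ) {p r : E d × ℝ → ℝ}
    (hp : p ∈ conePoly d n) (hr : r ∈ conePoly d n) :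
    sobolevInner d β s lam (a • p) r = a * sobolevInner d β s lam p r := by
  rw [sobolevInner_conePoly β s lam (Submodule.smul_mem _ a hp) hr,
    sobolevInner_conePoly β s lam hp hr]
  simp_rw [lastDeriv_smul, Pi.smul_apply, smul_eq_mul, mul_assoc, integral_const_mul]
  rw [mul_add, Finset.mul_sum]
  congr 1
  · ring
  · exact Finset.sum_congr rfl fun k _ => by ring

lemma mem_orthPolys_sobolevInner (hd : 1 ≤ d) (hβ : -(d : ℝ) < β + s) {P : E d × ℝ → ℝ} :
    P ∈ orthPolys d (sobolevInner d β s lam) n ↔ IsOrthPoly d (sobolevInner d β s lam) n P :=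
  mem_orthPolys (fun _ hp _ hq _ hr => sobolevInner_add_left hd hβ hp hq hr)
    (fun a _ hp _ hr => sobolevInner_smul_left a hp hr)

/-- Every summand is nonnegative, so all the Taylor data vanish, and these determine a polynomial.
-/
lemma eq_zero_of_sobolevInner_self (hd : 1 ≤ d) (hβ : -(d : ℝ) < β + s)
    (hlam : ∀ k < s, 0 < lam k) {p : E d × ℝ → ℝ} (hp : p ∈ conePoly d n)
    (h : sobolevInner d β s lam p p = 0) : p = 0 := by
  have hω := omega_pos hd
  rw [sobolevInner_conePoly β s lam hp hp] at h
  have h1 : 0 ≤ 1 / omega d *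
      ∫ z, lastDeriv s p z * lastDeriv s p z ∂(coneWeighted d (β + s) 0) :=
    mul_nonneg (by positivity) (integral_nonneg fun z => mul_self_nonneg _)
  have h2 : ∀ k ∈ Finset.range s, 0 ≤ lam k / omega d *
      ∫ ξ : Sph d, lastDeriv k p ((ξ : E d), 1) * lastDeriv k p ((ξ : E d), 1)
        ∂(sphereMeasure d) := fun k hk =>
    mul_nonneg (div_pos (hlam k (Finset.mem_range.1 hk)) hω).le
      (integral_nonneg fun z => mul_self_nonneg _)
  obtain ⟨h3, h4⟩ := (add_eq_zero_iff_of_nonneg h1 (Finset.sum_nonneg h2)).1 h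
  rw [Finset.sum_eq_zero_iff_of_nonneg h2] at h4
  refine eq_zero_of_lastDeriv_eq_zero hp (s := s) ?_ fun k hk => ?_
  · have h5 := (mul_eq_zero.1 h3).resolve_left (by positivity)
    rw [integral_eq_zero_iff_of_nonneg (fun x => mul_self_nonneg _)
      (MemLp.integrable_mul (memLp_lastDeriv hd hβ hp s) (memLp_lastDeriv hd hβ hp s))] at h5
    refine conePoly_eq_zero_of_ae hd (lastDeriv_mem hp s).1 (α := β + s) ?_
    filter_upwards [h5] with x hx using mul_self_eq_zero.1 hx
  · have h5 := (mul_eq_zero.1 (h4 k (Finset.mem_range.2 hk))).resolve_left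
      (div_pos (hlam k hk) hω).ne'
    exact conePoly_rim_eq_zero hd (lastDeriv_mem hp k).1
      (congrFun (eq_zero_of_integral_sq_eq_zero (continuous_rim_lastDeriv hp k) h5))

/-- Only linearity on polynomials enters: `f` stays in the left slot and is never added to anything.
-/
lemma sobolev_isOrthProj_unique (hd : 1 ≤ d) (hβ : -(d : ℝ) < β + s)
    (hlam : ∀ k < s, 0 < lam k) {f p p' : E d × ℝ → ℝ}
    (hp : IsOrthProj (sobolevInner d β s lam) (orthPolys d (sobolevInner d β s lam) n) f p)
    (hp' : IsOrthProj (sobolevInner d β s lam) (orthPolys d (sobolevInner d β s lam) n) f p') :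
    p' = p := by
  have hs := sub_mem hp'.1 hp.1
  have hle := orthPolys_le (sobolevInner d β s lam) n
  have h1 : sobolevInner d β s lam (p' + (-1 : ℝ) • p) (p' - p) = 0 := by
    rw [sobolevInner_add_left hd hβ (hle hp'.1) (Submodule.smul_mem _ _ (hle hp.1)) (hle hs),
      sobolevInner_smul_left _ (hle hp.1) (hle hs), ← hp.2 _ hs, ← hp'.2 _ hs]
    ring
  rw [neg_one_smul, ← sub_eq_add_neg] at h1
  exact sub_eq_zero.1 (eq_zero_of_sobolevInner_self hd hβ hlam (hle hs) h1)

/-! ### Structure of the Sobolev orthogonal polynomials -/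

lemma polyVal_mem_conePoly {m : ℕ} {Y : MvPolynomial (Fin d) ℝ} (hY : Y ∈ solidHarmonics d m) :
    (fun p : E d × ℝ => polyVal Y p.1) ∈ conePoly d m := by
  simpa using monomial_mem_conePoly (j := 0) (by omega) hY

lemma lastDeriv_iterate_lastPrimitive_polyVal_rim {m i k : ℕ} {Y : MvPolynomial (Fin d) ℝ}
    (hY : Y ∈ solidHarmonics d m) (x : E d) :
    lastDeriv i (lastPrimitive^[k] fun p : E d × ℝ => polyVal Y p.1) (x, 1) =
      if i = k then polyVal Y x else 0 := by
  rcases lt_trichotomy i k with h | rfl | h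
  · rw [lastDeriv_iterate_lastPrimitive_rim (polyVal_mem_conePoly hY) h, if_neg h.ne]
  · have := lastDeriv_iterate_lastPrimitive (polyVal_mem_conePoly hY) i 0
    rw [add_zero] at this
    simp [this]
  · rw [lastDeriv_iterate_lastPrimitive_polyVal hY h, if_neg h.ne']; rfl

/-- On the rim `q` is a sum of harmonics of degrees at most `k < N`. -/
lemma integral_polyVal_mul_rim (hd : 1 ≤ d) {k N : ℕ} {q : E d × ℝ → ℝ} (hq : q ∈ conePoly d k)
    (hk : k < N) {Y : MvPolynomial (Fin d) ℝ} (hY : Y ∈ solidHarmonics d N) :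
    ∫ ξ : Sph d, polyVal Y (ξ : E d) * q ((ξ : E d), 1) ∂(sphereMeasure d) = 0 := by
  obtain ⟨Z, hZ, h⟩ := conePoly_rim hq
  simp_rw [h, Finset.mul_sum]
  rw [integral_finsetSum]
  · refine Finset.sum_eq_zero fun m hm => integral_sphere_solidHarmonics_mul hd ?_ hY (hZ m)
    have := Finset.mem_range.1 hm
    omega
  · exact fun m _ => integrable_sphere
      ((continuous_polyVal_sphere _).mul (continuous_polyVal_sphere _))

/-- The test polynomial `J^s R` has zero rim derivatives of order below `s`, so the Sobolev form
only sees `∂_t^s q` against `R`. -/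
lemma lastDeriv_mem_orthPolys (hd : 1 ≤ d) {q : E d × ℝ → ℝ} (hq : IsOrthPoly d (sobolevInner d β s lam) n q) :
    lastDeriv s q ∈ orthPolys d (coneInner d (β + s) 0) (n - s) := by
  have hω := omega_pos hd
  refine Submodule.subset_span ⟨(lastDeriv_mem hq.1 s).1, fun k hk R hR => ?_⟩
  have h := hq.2 (k + s) (by omega) _ (iterate_lastPrimitive_mem hR s)
  have h1 := lastDeriv_iterate_lastPrimitive hR s 0
  rw [add_zero, Function.iterate_zero, id] at h1
  rw [sobolevInner_conePoly β s lam hq.1 (iterate_lastPrimitive_mem hR s), h1,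
    Finset.sum_eq_zero, add_zero] at h
  · rw [coneInner, (mul_eq_zero.1 h).resolve_left (by positivity), mul_zero]
  · intro i hi
    simp_rw [lastDeriv_iterate_lastPrimitive_rim hR (Finset.mem_range.1 hi)]
    simp

/-- The test polynomial `J^k Z = (t-1)^k/k! · Z` is killed by `∂_t^s`, and its only nonzero rim
derivative is the `k`-th. Hence `∂_t^k q(·,1)` is orthogonal to all harmonics of degree below `n -
k`. -/
lemma exists_rim_lastDeriv (hd : 1 ≤ d) (hlam : ∀ k < s, 0 < lam k)
    {q : E d × ℝ → ℝ} (hq : IsOrthPoly d (sobolevInner d β s lam) n q) {k : ℕ} (hk : k < s) :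
    ∃ Z ∈ solidHarmonics d (n - k), ∀ x, lastDeriv k q (x, 1) = polyVal Z x := by
  have hω := omega_pos hd
  refine conePoly_rim_solidHarmonic hd (lastDeriv_mem hq.1 k).1 fun j hj Z hZ => ?_
  have hmem := iterate_lastPrimitive_mem (polyVal_mem_conePoly hZ) k
  have h := hq.2 (j + k) (by omega) _ hmem
  rw [sobolevInner_conePoly β s lam hq.1 hmem, lastDeriv_iterate_lastPrimitive_polyVal hZ hk] at h
  simp only [Pi.zero_apply, mul_zero, integral_zero, zero_add] at h
  rw [Finset.sum_eq_single k] at h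
  · simp_rw [lastDeriv_iterate_lastPrimitive_polyVal_rim hZ, if_true] at h
    exact (mul_eq_zero.1 h).resolve_left (div_pos (hlam k hk) hω).ne'
  · intro i _ hi
    simp_rw [lastDeriv_iterate_lastPrimitive_polyVal_rim hZ, if_neg hi]
    simp
  · intro h; exact absurd (Finset.mem_range.2 hk) h

/-- The polynomial with rim derivatives `Y m` of order `m < s` and with derivative `P` of order
`s`, where data of negative degree are dropped. -/
noncomputable def ofRimData (s n : ℕ) (Y : ℕ → MvPolynomial (Fin d) ℝ) (P : E d × ℝ → ℝ) :
    E d × ℝ → ℝ :=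
  (∑ m ∈ Finset.range s,
    if m ≤ n then lastPrimitive^[m] (fun p : E d × ℝ => polyVal (Y m) p.1) else 0) +
  if s ≤ n then lastPrimitive^[s] P else 0

lemma ofRimData_term_mem {Y : ℕ → MvPolynomial (Fin d) ℝ}
    (hY : ∀ m, Y m ∈ solidHarmonics d (n - m)) (m : ℕ) :
    (if m ≤ n then lastPrimitive^[m] (fun p : E d × ℝ => polyVal (Y m) p.1) else 0) ∈
      conePoly d n := by
  split_ifs with h
  · simpa [h] using iterate_lastPrimitive_mem (polyVal_mem_conePoly (hY m)) m
  · exact zero_mem _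

lemma ofRimData_remainder_mem {P : E d × ℝ → ℝ} (hP : P ∈ conePoly d (n - s)) :
    (if s ≤ n then lastPrimitive^[s] P else 0) ∈ conePoly d n := by
  split_ifs with h
  · simpa [h] using iterate_lastPrimitive_mem hP s
  · exact zero_mem _

lemma lastDeriv_fun_zero (k : ℕ) : lastDeriv k (0 : E d × ℝ → ℝ) = 0 := by
  simpa using lastDeriv_smul 0 (0 : E d × ℝ → ℝ) k

variable {Y : ℕ → MvPolynomial (Fin d) ℝ} {P : E d × ℝ → ℝ}

lemma ofRimData_mem (hY : ∀ m, Y m ∈ solidHarmonics d (n - m)) (hP : P ∈ conePoly d (n - s)) :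
    ofRimData s n Y P ∈ conePoly d n :=
  add_mem (sum_mem fun m _ => ofRimData_term_mem hY m) (ofRimData_remainder_mem hP)

lemma lastDeriv_ofRimData (hY : ∀ m, Y m ∈ solidHarmonics d (n - m))
    (hP : P ∈ conePoly d (n - s)) (k : ℕ) :
    lastDeriv k (ofRimData s n Y P) =
      (∑ m ∈ Finset.range s, if m ≤ n then
        lastDeriv k (lastPrimitive^[m] (fun p : E d × ℝ => polyVal (Y m) p.1)) else 0) +
      if s ≤ n then lastDeriv k (lastPrimitive^[s] P) else 0 := by
  rw [ofRimData, lastDeriv_add (sum_mem fun m _ => ofRimData_term_mem hY m)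
    (ofRimData_remainder_mem hP), lastDeriv_sum _ fun m _ => ofRimData_term_mem hY m]
  simp only [apply_ite (lastDeriv k), lastDeriv_fun_zero]

lemma lastDeriv_ofRimData_top (hY : ∀ m, Y m ∈ solidHarmonics d (n - m))
    (hP : P ∈ conePoly d (n - s)) :
    lastDeriv s (ofRimData s n Y P) = if s ≤ n then P else 0 := by
  have h := lastDeriv_iterate_lastPrimitive hP s 0
  rw [add_zero, Function.iterate_zero, id] at h
  rw [lastDeriv_ofRimData hY hP, h, Finset.sum_eq_zero, zero_add]
  intro m hm
  rw [lastDeriv_iterate_lastPrimitive_polyVal (hY m) (Finset.mem_range.1 hm), ite_self]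

lemma lastDeriv_ofRimData_rim (hY : ∀ m, Y m ∈ solidHarmonics d (n - m))
    (hP : P ∈ conePoly d (n - s)) {k : ℕ} (hk : k < s) (x : E d) :
    lastDeriv k (ofRimData s n Y P) (x, 1) = if k ≤ n then polyVal (Y k) x else 0 := by
  rw [lastDeriv_ofRimData hY hP, Pi.add_apply, Finset.sum_apply, Finset.sum_eq_single k]
  · have h1 := lastDeriv_iterate_lastPrimitive_polyVal_rim (i := k) (k := k) (hY k) x
    have h2 := lastDeriv_iterate_lastPrimitive_rim hP hk x
    split_ifs <;> simp_all
  · intro m _ hm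
    have h1 := lastDeriv_iterate_lastPrimitive_polyVal_rim (i := k) (k := m) (hY m) x
    rw [if_neg hm.symm] at h1
    split_ifs
    · exact h1
    · rfl
  · intro h; exact absurd (Finset.mem_range.2 hk) h

/-- For `Q` of degree `k < n`, each datum of `Q` either vanishes or has degree below that of the
matching datum of `ofRimData`, so every summand of the form is zero. -/
lemma ofRimData_mem_orthPolys (hd : 1 ≤ d) (hβ : -(d : ℝ) < β + s)
    (hY : ∀ m, Y m ∈ solidHarmonics d (n - m))
    (hP : P ∈ orthPolys d (coneInner d (β + s) 0) (n - s)) :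
    ofRimData s n Y P ∈ orthPolys d (sobolevInner d β s lam) n := by
  obtain ⟨hP1, hP2⟩ := (mem_orthPolys_coneInner hd hβ).1 hP
  refine Submodule.subset_span ⟨ofRimData_mem hY hP1, fun k hk Q hQ => ?_⟩
  rw [sobolevInner_conePoly β s lam (ofRimData_mem hY hP1) hQ, lastDeriv_ofRimData_top hY hP1,
    Finset.sum_eq_zero, add_zero]
  · by_cases hs : s ≤ k
    · have h := hP2 (k - s) (by omega) _ (lastDeriv_mem hQ s).1
      rw [if_pos (by omega), (mul_eq_zero.1 h).resolve_left (coneNormConst_pos hd hβ).ne', mul_zero]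
    · rw [(lastDeriv_mem hQ s).2 (by omega)]
      simp
  · intro i hi
    simp_rw [lastDeriv_ofRimData_rim hY hP1 (Finset.mem_range.1 hi)]
    by_cases hik : i ≤ k
    · simp_rw [if_pos (show i ≤ n by omega)]
      rw [integral_polyVal_mul_rim hd (lastDeriv_mem hQ i).1 (by omega) (hY i), mul_zero]
    · rw [(lastDeriv_mem hQ i).2 (by omega)]
      simp

/-- The data of an orthogonal polynomial `q` lie in the very spaces onto which the data of `f` are
projected, so the two Sobolev products agree summand by summand once the normalizing constants are
cancelled. -/
lemma isOrthProj_ofRimData (hd : 1 ≤ d) (hβ : -(d : ℝ) < β + s) (hlam : ∀ k < s, 0 < lam k)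
    {f : E d × ℝ → ℝ} (hY : ∀ m, Y m ∈ solidHarmonics d (n - m))
    (hYf : ∀ m < s, IsOrthProj (sphereInner d) (sphericalHarmonics d (n - m)) (rimDeriv m f)
      (restrictSphere d (Y m)))
    (hP : IsOrthProj (coneInner d (β + s) 0) (orthPolys d (coneInner d (β + s) 0) (n - s))
      (tDeriv s f) P) :
    IsOrthProj (sobolevInner d β s lam) (orthPolys d (sobolevInner d β s lam) n) f
      (ofRimData s n Y P) := by
  have hω := omega_pos hd
  have hP1 := orthPolys_le _ _ hP.1
  refine ⟨ofRimData_mem_orthPolys hd hβ hY hP.1, fun q hq => ?_⟩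
  have hq := (mem_orthPolys_sobolevInner hd hβ).1 hq
  rw [sobolevInner_conePoly β s lam (ofRimData_mem hY hP1) hq.1,
    sobolevInner_conePoly_right β s lam f hq.1, lastDeriv_ofRimData_top hY hP1]
  refine congrArg₂ (· + ·) (congrArg _ ?_) ?_
  · by_cases hs : s ≤ n
    · rw [if_pos hs]
      exact mul_left_cancel₀ (coneNormConst_pos hd hβ).ne'
        (hP.2 _ (lastDeriv_mem_orthPolys hd hq))
    -- For `n < s` the truncated `n - s` is `0` and `P` carries no information; both sides vanish
    -- because `∂_t^s q = 0`.
    · rw [(lastDeriv_mem hq.1 s).2 (by omega)]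
      simp
  · refine Finset.sum_congr rfl fun k hk => ?_
    have hk := Finset.mem_range.1 hk
    simp_rw [lastDeriv_ofRimData_rim hY hP1 hk]
    by_cases hkn : k ≤ n
    · obtain ⟨Z, hZ, hqZ⟩ := exists_rim_lastDeriv hd hlam hq hk
      have h := (hYf k hk).2 (restrictSphere d Z) (Submodule.mem_map_of_mem hZ)
      simp_rw [hqZ, if_pos hkn]
      exact congrArg _ (mul_left_cancel₀ (one_div_pos.2 hω).ne' h)
    · rw [(lastDeriv_mem hq.1 k).2 (by omega)]
      simp

end ConicSobolev

/-! ### The projection formula -/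

theorem mainTheorem2 (d : ℕ) (hd : 1 ≤ d) (s : ℕ) (hs : 1 ≤ s) (β : ℝ)
    (hβ : -(d : ℝ) - s < β) (lam : ℕ → ℝ) (hlam : ∀ k < s, 0 < lam k)
    (f : ConicSobolev.E d × ℝ → ℝ) (hf : ConicSobolev.TDifferentiable s f)
    (hfs : MemLp (ConicSobolev.tDeriv s f) 2 (ConicSobolev.coneWeighted d (β + s) 0))
    (hrim : ∀ k < s, MemLp (ConicSobolev.rimDeriv k f) 2 (ConicSobolev.sphereMeasure d))
    (n : ℕ) :
    -- the three kinds of orthogonal projections in the formula are well defined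
    (∃! p, ConicSobolev.IsOrthProj (ConicSobolev.sobolevInner d β s lam)
      (ConicSobolev.orthPolys d (ConicSobolev.sobolevInner d β s lam) n) f p) ∧
    (∀ m < s, m ≤ n → ∃! p, ConicSobolev.IsOrthProj (ConicSobolev.sphereInner d)
      (ConicSobolev.sphericalHarmonics d (n - m)) (ConicSobolev.rimDeriv m f) p) ∧
    (s ≤ n → ∃! p, ConicSobolev.IsOrthProj (ConicSobolev.coneInner d (β + s) 0)
      (ConicSobolev.orthPolys d (ConicSobolev.coneInner d (β + s) 0) (n - s))
      (ConicSobolev.tDeriv s f) p) ∧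
    -- the formula; projections of negative degree are zero
    ∀ (x : ConicSobolev.E d) (t : ℝ) (ξ : ConicSobolev.Sph d),
      (x, t) ∈ ConicSobolev.coneSurface d → x = t • (ξ : ConicSobolev.E d) →
      ConicSobolev.sobolevProj d β s lam n f (x, t) =
        (∑ m ∈ Finset.range s, if m ≤ n then
          (t - 1) ^ m / (m.factorial : ℝ) *
            (t ^ (n - m) * ConicSobolev.sphereProj d (n - m) (ConicSobolev.rimDeriv m f) ξ)
          else 0) +
        (if s ≤ n then
          (-1) ^ s * ∫ v in t..1, (v - t) ^ (s - 1) / ((s - 1).factorial : ℝ) *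
            ConicSobolev.coneProj d (β + s) 0 (n - s) (ConicSobolev.tDeriv s f) (x, v)
          else 0) := by
  have hβs : -(d : ℝ) < β + s := by linarith
  have hS (m : ℕ) (hm : m < s) := ConicSobolev.existsUnique_sphereProj hd (n - m) (hrim m hm)
  have hC := ConicSobolev.existsUnique_coneProj hd hβs (n - s) hfs
  have hS' (m : ℕ) (hm : m < s) := ConicSobolev.isOrthProj_orthProj (hS m hm)
  have hC' := ConicSobolev.isOrthProj_orthProj hC
  -- The sphere projections are lifted to solid harmonics; the zero polynomial for `m ≥ s` only
  -- makes the choice total.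
  have hex (m : ℕ) : ∃ Y ∈ ConicSobolev.solidHarmonics d (n - m), m < s →
      ConicSobolev.restrictSphere d Y =
        ConicSobolev.sphereProj d (n - m) (ConicSobolev.rimDeriv m f) := by
    by_cases hm : m < s
    · obtain ⟨Y, hY, h⟩ := (hS' m hm).1
      exact ⟨Y, hY, fun _ => h⟩
    · exact ⟨0, zero_mem _, fun h => absurd h hm⟩
  choose Y hY hYf using hex
  have hp := ConicSobolev.isOrthProj_ofRimData (lam := lam) hd hβs hlam hY
    (fun m hm => by rw [hYf m hm]; exact hS' m hm) hC'
  have hu : ∃! p, ConicSobolev.IsOrthProj (ConicSobolev.sobolevInner d β s lam)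
      (ConicSobolev.orthPolys d (ConicSobolev.sobolevInner d β s lam) n) f p :=
    ⟨_, hp, fun _ hp' => ConicSobolev.sobolev_isOrthProj_unique hd hβs hlam hp hp'⟩
  refine ⟨hu, fun m hm _ => hS m hm, fun _ => hC, fun x t ξ _ hx => ?_⟩
  have heq : ConicSobolev.sobolevProj d β s lam n f = _ :=
    hu.unique (ConicSobolev.isOrthProj_orthProj hu) hp
  rw [heq, ConicSobolev.ofRimData, Pi.add_apply, Finset.sum_apply]
  congr 1
  · refine Finset.sum_congr rfl fun m hm => ?_
    split_ifs
    · rw [ConicSobolev.iterate_lastPrimitive_polyVal, ← hYf m (Finset.mem_range.1 hm)]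
      -- Homogeneity on the ray through `ξ` yields the factor `t ^ (n - m)`.
      subst hx
      rw [ConicSobolev.polyVal_smul (hY m).1]
      rfl
    · rfl
  · split_ifs
    · exact ConicSobolev.iterate_lastPrimitive_eq_integral
        (ConicSobolev.orthPolys_le _ _ hC'.1) hs x t
    · rfl
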